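/- Let $f:\{0,1\}^n\to\{0,1\}$ be computed by a read-once DNF with two non-empty terms, that is, $f$ is the disjunction of two non-empty conjunctions of literals in which each variable appears at most once altogether. Let $\mathcal D$ be the distribution of $(x,f(x))$ for $x$ uniform on $\{0,1\}^n$. For a decision tree $T$ with internal nodes labelled by features $x_i$ and leaves labelled by $0$ or $1$, let $E(T)=\Pr_{\mathcal D}[T(x)\ne f(x)]$, and let $\mathrm{OPT}(\mathcal D,t)$ be the minimum of $E(T)$ over all trees $T$ with at most $t$ internal nodes. For a leaf $l$ let $p(l)$ be the probability that $x$ reaches $l$ and $q(l)$ the probability that $f(x)=1$ given that $x$ reaches $l$. Put $H(T)=\sum_{l}p(l)H(q(l))$, where the sum is over the leaves of $T$ and $H(x)=-x\log_2 x-(1-x)\log_2(1-x)$ with $0\log_2 0=0$. The algorithm TopDown starts with the tree $T_0$ that is a single leaf with the majority label. In iteration $t\ge 1$ it goes, in some order, through all pairs $(l,i)$ of a leaf $l$ of $T_{t-1}$ and a feature $i$ that is not on the path from the root to $l$, and it obtains $T_t$ from $T_{t-1}$ by performing the last split in this order that attains the maximum of $H(T_{t-1})-H(T_{t-1}(l,i))$.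 Here $T(l,i)$ is $T$ with $l$ replaced by an internal node labelled $x_i$ with two leaves, each labelled $1$ if $q\ge\frac12$ there and $0$ otherwise. If there is no such pair, then $T_t=T_{t-1}$. Then, for any rule that fixes the order of the pairs for each tree (so for any such tie-breaking) and every integer $t^*>0$, the mean iteration statistical consistency (MIC) of TopDown is zero: $$m_{\mathcal D}^{\mathrm{TopDown}}(t^*)=\frac1{t^*}\sum_{t=1}^{t^*}\bigl(E(T_t)-\mathrm{OPT}(\mathcal D,t)\bigr)=0 .$$ -/

import Mathlib

namespace TopDownMIC

/-! ### Disjunctive normal forms -/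

/-- A literal over the variables `x_0, …, x_{n-1}`: the pair `(i, true)` is `x_i` and the pair
`(i, false)` is its negation. -/
abbrev Literal (n : ℕ) := Fin n × Bool

/-- A conjunction of literals. -/
abbrev Term (n : ℕ) := List (Literal n)

/-- The conjunction `c` is true at the point `x`. -/
def Term.Holds {n : ℕ} (c : Term n) (x : Fin n → Bool) : Prop :=
  ∀ a ∈ c, x a.1 = a.2

/-- A DNF formula: the disjunction of a list of terms. -/
abbrev DNF (n : ℕ) := List (Term n)

open Classical in
/-- The Boolean function computed by a DNF. -/
noncomputable def DNF.eval {n : ℕ} (φ : DNF n) (x : Fin n → Bool) : Bool :=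
  decide (∃ c ∈ φ, Term.Holds c x)

/-- In the whole formula each variable appears at most once. -/
def DNF.ReadOnce {n : ℕ} (φ : DNF n) : Prop :=
  (φ.flatten.map Prod.fst).Nodup

/-! ### Distributions on labelled examples -/

/-- A distribution on `{0,1}^n × {0,1}`. -/
abbrev Dist (n : ℕ) := PMF ((Fin n → Bool) × Bool)

/-- The distribution of `(x, f x)` for `x` uniform on `{0,1}^n`. -/
noncomputable def uniformDist {n : ℕ} (f : (Fin n → Bool) → Bool) : Dist n :=
  (PMF.uniformOfFintype (Fin n → Bool)).map (fun x => (x, f x))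

/-- The probability of an event. -/
noncomputable def prob {n : ℕ} (D : Dist n) (A : Set ((Fin n → Bool) × Bool)) : ℝ :=
  (D.toOuterMeasure A).toReal

/-! ### Decision trees -/

/-- Decision trees over `n` Boolean features. In `node i t₀ t₁` the point `x` goes to `t₀` if
`x i = false` and to `t₁` if `x i = true`. -/
inductive DTree (n : ℕ) : Type
  | leaf (label : Bool) : DTree n
  | node (i : Fin n) (t₀ t₁ : DTree n) : DTree n

/-- The label that the tree gives to `x`. -/
def DTree.eval {n : ℕ} : DTree n → (Fin n → Bool) → Bool
  | .leaf b, _ => b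
  | .node i t₀ t₁, x => if x i then t₁.eval x else t₀.eval x

/-- The number of internal nodes. -/
def DTree.size {n : ℕ} : DTree n → ℕ
  | .leaf _ => 0
  | .node _ t₀ t₁ => t₀.size + t₁.size + 1

/-- The path from the root to a node, as the list of the tests on the path with their outcomes.
A point `x` follows the path exactly if `Term.Holds` is true of it. -/
abbrev Path (n : ℕ) := Term n

/-- The leaves of a tree, each given by the path that leads to it (different leaves have different
paths). -/
def DTree.leaves {n : ℕ} : DTree n → List (Path n)
  | .leaf _ => [[]]
  | .node i t₀ t₁ =>
      (t₀.leaves.map fun l => (i, false) :: l) ++ (t₁.leaves.map fun l => (i, true) :: l)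

/-- `p(l)`: the probability of reaching `l`. -/
noncomputable def reachProb {n : ℕ} (D : Dist n) (l : Path n) : ℝ :=
  prob D {z | Term.Holds l z.1}

/-- `q(l)`: the conditional probability of the label `1`, given that `l` is reached. -/
noncomputable def condProb {n : ℕ} (D : Dist n) (l : Path n) : ℝ :=
  prob D {z | Term.Holds l z.1 ∧ z.2 = true} / reachProb D l

open Classical in
/-- The label of a leaf: `1` if `q(l) ≥ 1/2` and `0` otherwise. -/
noncomputable def majority {n : ℕ} (D : Dist n) (l : Path n) : Bool :=
  decide (1 / 2 ≤ condProb D l)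

/-- `T.replace l S` is `T` with the leaf `l` replaced by the tree `S`. -/
def DTree.replace {n : ℕ} : DTree n → Path n → DTree n → DTree n
  | .leaf _, [], S => S
  | .node i t₀ t₁, (_, false) :: l, S => .node i (t₀.replace l S) t₁
  | .node i t₀ t₁, (_, true) :: l, S => .node i t₀ (t₁.replace l S)
  | T, _, _ => T

/-- `T(l, i)`: the leaf `l` is replaced by an internal node with the feature `i` and two leaves
with majority labels. -/
noncomputable def DTree.split {n : ℕ} (D : Dist n) (T : DTree n) (l : Path n) (i : Fin n) :
    DTree n :=
  T.replace l
    (.node i (.leaf (majority D (l ++ [(i, false)]))) (.leaf (majority D (l ++ [(i, true)]))))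

/-- The test error `E(T)`. -/
noncomputable def testError {n : ℕ} (D : Dist n) (T : DTree n) : ℝ :=
  prob D {z | T.eval z.1 ≠ z.2}

/-- The binary entropy function, with logarithm in base 2 and `0 log 0 = 0`. -/
noncomputable def entropy (x : ℝ) : ℝ :=
  -x * Real.logb 2 x - (1 - x) * Real.logb 2 (1 - x)

/-- The entropy `H(T)` of a tree: the sum of `p(l) H(q(l))` over its leaves. -/
noncomputable def treeEntropy {n : ℕ} (D : Dist n) (T : DTree n) : ℝ :=
  (T.leaves.map fun l => reachProb D l * entropy (condProb D l)).sum

/-! ### The algorithm TopDown -/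

/-- The pairs of a leaf `l` of `T` and a feature `i` that is not on the path to `l`. -/
def DTree.pairs {n : ℕ} (T : DTree n) : List (Path n × Fin n) :=
  T.leaves.flatMap fun l =>
    ((List.finRange n).filter fun i => decide (i ∉ l.map Prod.fst)).map fun i => (l, i)

/-- A rule that says in which order the inner loop of TopDown goes through the pairs. It determines
how ties are broken. -/
def IsLoopOrder {n : ℕ} (order : DTree n → List (Path n × Fin n)) : Prop :=
  ∀ T, (order T).Perm T.pairs

/-- The body of the inner loop. The state is `Δ_best` with the best pair so far, if any. -/
noncomputable def scan {n : ℕ} (D : Dist n) (T : DTree n)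
    (best : ℝ × Option (Path n × Fin n)) (c : Path n × Fin n) : ℝ × Option (Path n × Fin n) :=
  let Δ := treeEntropy D T - treeEntropy D (T.split D c.1 c.2)
  if best.1 ≤ Δ then (Δ, some c) else best

/-- One iteration: split the best leaf with the best feature. A tree with no pair left to split
(every feature is on the path to every leaf) stays as it is. -/
noncomputable def topDownStep {n : ℕ} (order : DTree n → List (Path n × Fin n)) (D : Dist n)
    (T : DTree n) : DTree n :=
  match ((order T).foldl (scan D T) (0, none)).2 with
  | some c => T.split D c.1 c.2
  | none => T

/-- The output of TopDown after `t` iterations, each of which adds one internal node. -/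
noncomputable def topDown {n : ℕ} (order : DTree n → List (Path n × Fin n)) (D : Dist n) :
    ℕ → DTree n
  | 0 => .leaf (majority D [])
  | t + 1 => topDownStep order D (topDown order D t)

/-! ### Mean iteration statistical consistency -/

/-- `OPT(D, t)`: the minimal test error among all trees with at most `t` internal nodes. -/
noncomputable def opt {n : ℕ} (D : Dist n) (t : ℕ) : ℝ :=
  sInf (testError D '' {T | T.size ≤ t})

/-- The constant `ε_t` of an algorithm `A`. -/
noncomputable def micConst {n : ℕ} (A : Dist n → ℕ → DTree n) (D : Dist n) (t : ℕ) : ℝ :=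
  testError D (A D t) - opt D t

/-- The mean iteration statistical consistency (MIC) of an algorithm `A`. -/
noncomputable def mic {n : ℕ} (A : Dist n → ℕ → DTree n) (D : Dist n) (tStar : ℕ) : ℝ :=
  (1 / (tStar : ℝ)) * ∑ t ∈ Finset.Icc 1 tStar, micConst A D t

/-- The infimum in `opt` is a minimum. -/
theorem isLeast_opt {n : ℕ} (D : Dist n) (t : ℕ) :
    IsLeast (testError D '' {T | T.size ≤ t}) (opt D t) := by
  have hfin : (testError D '' {T | T.size ≤ t}).Finite := by
    refine (Set.finite_range (prob D)).subset ?_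
    rintro _ ⟨T, _, rfl⟩
    exact ⟨_, rfl⟩
  have hne : (testError D '' {T | T.size ≤ t}).Nonempty :=
    ⟨_, .leaf true, by simp [DTree.size], rfl⟩
  exact ⟨hne.csInf_mem hfin, fun _ h => csInf_le hfin.bddBelow h⟩

theorem DTree.size_replace_le {n : ℕ} (T : DTree n) (l : Path n) (S : DTree n) :
    (T.replace l S).size ≤ T.size + S.size := by
  induction T generalizing l with
  | leaf b => cases l <;> simp [DTree.replace, DTree.size]
  | node i t₀ t₁ ih₀ ih₁ =>
    match l with
    | [] => simp [DTree.replace]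
    | (_, false) :: l => have := ih₀ l; simp only [DTree.replace, DTree.size]; omega
    | (_, true) :: l => have := ih₁ l; simp only [DTree.replace, DTree.size]; omega

/-- TopDown outputs a tree with at most `t` internal nodes after `t` iterations. -/
theorem size_topDown_le {n : ℕ} (order : DTree n → List (Path n × Fin n)) (D : Dist n) (t : ℕ) :
    (topDown order D t).size ≤ t := by
  induction t with
  | zero => simp [topDown, DTree.size]
  | succ t ih =>
    simp only [topDown, topDownStep]
    split
    · refine (DTree.size_replace_le _ _ _).trans ?_
      simp only [DTree.size]
      omega
    · omega

end TopDownMIC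

namespace TopDownMIC

/-! ### Probabilities of conjunctions -/

/-! Let the terms have `a ≤ b` literals. Under the uniform distribution a node matters only through
its depth and the number of undecided literals of each term (`none` once the term is false): there
`q = u + v - u * v`, where `u` and `v` are `0` or powers of `1/2`. So a tree may be replaced by the
multiset of the types of its leaves.

The greedy tree is forced at this level. It tests the shorter term along one spine, which leaves
side branches at depths `1, …, a` where only the longer term is alive. Then it finishes these
branches with `b` tests each, the shallowest and hence heaviest first. After that `f` is constant on
every leaf. Counted on a cube of dimension `a + b`, its errors are `leastErrors a b t`: all `2 ^ a +
2 ^ b - 1` satisfying points while every label is `0`; two fewer at `t + 1 = a`, where the spine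
leaf gets label `1`; and `2 ^ (a - m) - 1` once the spine and `m` branches are finished, because
branch `j` contains `2 ^ (a - j)` satisfying points.

No tree does better (`errorBound_le_errAt`): by induction on the tree, since `leastErrors` satisfies
a Bellman inequality whichever term the root tests (`leastErrors_step_left`,
`leastErrors_step_right`).

The greedy choices follow from three strict comparisons of entropy gains: at the spine leaf the
shorter term beats the longer one (`splitGain_lt_splitGain`), the spine leaf beats every side branch
(`splitGain_spine`), and the current branch beats every deeper untouched one
(`splitGain_unfinished`). Hence, before all leaves are pure, ties only concern which literal of a
term is tested, or, if `a = b`, which term is tested at the root; by symmetry neither affects the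
error. -/

open Classical in
/-- The proportion of the points of the cube that satisfy `g`. -/
noncomputable def pr {n : ℕ} (g : (Fin n → Bool) → Prop) : ℝ :=
  ((Finset.univ.filter g).card : ℝ) / 2 ^ n

theorem prob_uniformDist {n : ℕ} (f : (Fin n → Bool) → Bool) (A : Set ((Fin n → Bool) × Bool)) :
    prob (uniformDist f) A = pr fun x => (x, f x) ∈ A := by
  classical
  unfold prob uniformDist pr
  rw [PMF.toOuterMeasure_map_apply, PMF.toOuterMeasure_uniformOfFintype_apply]
  simp [Fintype.card_subtype]

theorem pr_congr {n : ℕ} {g h : (Fin n → Bool) → Prop} (H : ∀ x, g x ↔ h x) : pr g = pr h := by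
  congr 1; ext x; exact H x

theorem pr_add {n : ℕ} (g h k : (Fin n → Bool) → Prop) (hd : ∀ x, ¬ (g x ∧ h x))
    (hk : ∀ x, k x ↔ g x ∨ h x) : pr k = pr g + pr h := by
  classical
  unfold pr
  rw [← add_div, ← Nat.cast_add, ← Finset.card_union_of_disjoint]
  · congr 3
    ext x
    simp [hk]
  · rw [Finset.disjoint_left]
    intro x hx hx'
    simp only [Finset.mem_filter, Finset.mem_univ, true_and] at hx hx'
    exact hd x ⟨hx, hx'⟩

theorem pr_false {n : ℕ} (g : (Fin n → Bool) → Prop) (h : ∀ x, ¬ g x) : pr g = 0 := by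
  classical
  unfold pr
  simp [Finset.filter_false_of_mem, h]

theorem pr_true {n : ℕ} (g : (Fin n → Bool) → Prop) (h : ∀ x, g x) : pr g = 1 := by
  classical
  unfold pr
  simp [Finset.filter_true_of_mem, h]

theorem pr_equiv {n : ℕ} (e : (Fin n → Bool) ≃ (Fin n → Bool)) {g h : (Fin n → Bool) → Prop}
    (H : ∀ x, g x ↔ h (e x)) : pr g = pr h := by
  classical
  unfold pr
  congr 2
  exact Finset.card_equiv e (by simp [H])

/-- The points of the cube with the coordinate `i` flipped. -/
def flipAt {n : ℕ} (i : Fin n) : (Fin n → Bool) ≃ (Fin n → Bool) where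
  toFun x := Function.update x i (!x i)
  invFun x := Function.update x i (!x i)
  left_inv x := by simp
  right_inv x := by simp

theorem holds_cons {n : ℕ} (a : Literal n) (l : Term n) (x : Fin n → Bool) :
    Term.Holds (a :: l) x ↔ x a.1 = a.2 ∧ Term.Holds l x := by
  simp [Term.Holds]

theorem holds_append {n : ℕ} (l m : Term n) (x : Fin n → Bool) :
    Term.Holds (l ++ m) x ↔ Term.Holds l x ∧ Term.Holds m x := by
  simp only [Term.Holds, List.mem_append, or_imp, forall_and]

theorem holds_concat {n : ℕ} (l : Term n) (a : Literal n) (x : Fin n → Bool) :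
    Term.Holds (l ++ [a]) x ↔ Term.Holds l x ∧ x a.1 = a.2 := by
  rw [holds_append]; simp [Term.Holds]

/-- Each literal halves the set: flipping its coordinate exchanges the two halves and leaves the
remaining literals alone, as they use other variables. -/
theorem pr_holds {n : ℕ} (l : Term n) (hl : (l.map Prod.fst).Nodup) :
    pr (Term.Holds l) = (1 / 2) ^ l.length := by
  induction l with
  | nil => rw [pr_true]; · simp
           simp [Term.Holds]
  | cons a l ih =>
    rw [List.map_cons, List.nodup_cons] at hl
    have h1 := pr_add (fun x => x a.1 = a.2 ∧ Term.Holds l x)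
      (fun x => x a.1 = (!a.2) ∧ Term.Holds l x) (Term.Holds l)
      (by rintro x ⟨⟨h, -⟩, h', -⟩; rw [h] at h'; simp at h')
      (by intro x; cases x a.1 <;> cases a.2 <;> simp)
    have h2 : pr (fun x => x a.1 = a.2 ∧ Term.Holds l x) =
        pr (fun x => x a.1 = (!a.2) ∧ Term.Holds l x) := by
      refine pr_equiv (flipAt a.1) fun x => and_congr ?_ ?_
      · simp [flipAt]
      · refine forall₂_congr fun b hb => ?_
        have : b.1 ≠ a.1 := fun h => hl.1 (h ▸ List.mem_map_of_mem hb)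
        simp [flipAt, Function.update_of_ne this]
    have h3 : pr (Term.Holds (a :: l)) = pr (fun x => x a.1 = a.2 ∧ Term.Holds l x) :=
      pr_congr fun x => holds_cons a l x
    rw [h3, List.length_cons, pow_succ, ← ih hl.2]
    linarith

/-- The number of literals of `c` that are not yet known to be true at the end of the path `l`, and
`none` if one of them is known to be false. -/
def rem {n : ℕ} (c : Term n) (l : Path n) : Option ℕ :=
  if ∃ a ∈ c, (a.1, !a.2) ∈ l then none else some (c.filter fun a => a ∉ l).length

/-- The probability that a conjunction is true, from the number of undecided literals. -/
noncomputable def val : Option ℕ → ℝ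
  | none => 0
  | some k => (1 / 2) ^ k

theorem pr_holds_and {n : ℕ} (l c : Term n) (hl : (l.map Prod.fst).Nodup)
    (hc : (c.map Prod.fst).Nodup) :
    pr (fun x => Term.Holds l x ∧ Term.Holds c x) = (1 / 2) ^ l.length * val (rem c l) := by
  unfold rem
  split_ifs with h
  · obtain ⟨a, ha, hal⟩ := h
    rw [pr_false]
    · simp [val]
    · rintro x ⟨h1, h2⟩
      have := h1 _ hal
      simp [h2 _ ha] at this
  · push Not at h
    have : pr (fun x => Term.Holds l x ∧ Term.Holds c x) =
        pr (Term.Holds (l ++ c.filter fun a => a ∉ l)) := by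
      refine pr_congr fun x => ?_
      rw [holds_append]
      refine and_congr_right fun hx => ⟨fun H a ha => H a (List.mem_of_mem_filter ha), ?_⟩
      intro H a ha
      by_cases hal : a ∈ l
      · exact hx a hal
      · exact H a (by simp [ha, hal])
    rw [this, pr_holds]
    · simp [val, pow_add]
    · rw [List.map_append, List.nodup_append]
      refine ⟨hl, hc.sublist (List.filter_sublist.map _), ?_⟩
      rintro i hi j hj rfl
      obtain ⟨⟨i, s⟩, ha, rfl⟩ := List.mem_map.1 hi
      obtain ⟨⟨j, s'⟩, hb, hij⟩ := List.mem_map.1 hj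
      simp only [List.mem_filter, decide_eq_true_eq] at hb hij
      subst hij
      have := h _ hb.1
      cases s <;> cases s' <;> simp_all

theorem val_rem_append {n : ℕ} (c d : Term n) (l : Path n) :
    val (rem (c ++ d) l) = val (rem c l) * val (rem d l) := by
  unfold rem
  by_cases h1 : ∃ a ∈ c, (a.1, !a.2) ∈ l
  · rw [if_pos h1, if_pos (by obtain ⟨a, h, h'⟩ := h1; exact ⟨a, by simp [h], h'⟩)]; simp [val]
  by_cases h2 : ∃ a ∈ d, (a.1, !a.2) ∈ l
  · rw [if_pos h2, if_pos (by obtain ⟨a, h, h'⟩ := h2; exact ⟨a, by simp [h], h'⟩)]; simp [val]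
  rw [if_neg h1, if_neg h2, if_neg]
  · simp [val, pow_add]
  · rintro ⟨a, h, h'⟩
    rcases List.mem_append.1 h with h | h
    · exact h1 ⟨a, h, h'⟩
    · exact h2 ⟨a, h, h'⟩

/-- The probability of the disjunction of two independent events. -/
def orProb (u v : ℝ) : ℝ := u + v - u * v

/-- `f` is the disjunction of the terms `c` and `d`, which have no repeated variable. -/
structure TwoTerm {n : ℕ} (f : (Fin n → Bool) → Bool) (c d : Term n) : Prop where
  eval : ∀ x, f x = true ↔ Term.Holds c x ∨ Term.Holds d x
  nodup : ((c ++ d).map Prod.fst).Nodup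

theorem TwoTerm.symm {n : ℕ} {f : (Fin n → Bool) → Bool} {c d : Term n} (h : TwoTerm f c d) :
    TwoTerm f d c where
  eval x := (h.eval x).trans or_comm
  nodup := by
    have := h.nodup
    rw [List.map_append] at this ⊢
    exact (List.perm_append_comm.nodup_iff).1 this

theorem TwoTerm.nodup_left {n : ℕ} {f : (Fin n → Bool) → Bool} {c d : Term n}
    (h : TwoTerm f c d) : (c.map Prod.fst).Nodup := by
  have := h.nodup
  rw [List.map_append] at this
  exact this.of_append_left

theorem TwoTerm.disjoint {n : ℕ} {f : (Fin n → Bool) → Bool} {c d : Term n}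
    (h : TwoTerm f c d) {i : Fin n} (hc : i ∈ c.map Prod.fst) (hd : i ∈ d.map Prod.fst) : False := by
  have := h.nodup
  rw [List.map_append, List.nodup_append] at this
  exact this.2.2 i hc i hd rfl

/-- Inclusion–exclusion. The terms share no variable, so `c ++ d` is again a conjunction without
repeated variables and its probability is the product. -/
theorem TwoTerm.pr_true {n : ℕ} {f : (Fin n → Bool) → Bool} {c d : Term n}
    (h : TwoTerm f c d) (l : Path n) (hl : (l.map Prod.fst).Nodup) :
    pr (fun x => Term.Holds l x ∧ f x = true) =
      (1 / 2) ^ l.length * orProb (val (rem c l)) (val (rem d l)) := by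
  have h1 := pr_holds_and l c hl h.nodup_left
  have h2 := pr_holds_and l d hl h.symm.nodup_left
  have h3 := pr_holds_and l (c ++ d) hl h.nodup
  have h4 := pr_add (fun x => Term.Holds l x ∧ Term.Holds c x)
    (fun x => Term.Holds l x ∧ ¬ Term.Holds c x ∧ Term.Holds d x)
    (fun x => Term.Holds l x ∧ f x = true) (by tauto) (by intro x; rw [h.eval]; tauto)
  have h5 := pr_add (fun x => Term.Holds l x ∧ Term.Holds (c ++ d) x)
    (fun x => Term.Holds l x ∧ ¬ Term.Holds c x ∧ Term.Holds d x)
    (fun x => Term.Holds l x ∧ Term.Holds d x) (by intro x; rw [holds_append]; tauto)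
    (by intro x; rw [holds_append]; tauto)
  rw [val_rem_append] at h3
  unfold orProb
  linarith

/-- One more literal of a conjunction is known to be true. -/
def down : Option ℕ → Option ℕ
  | none => none
  | some k => some (k - 1)

theorem rem_concat_of_notMem {n : ℕ} (c : Term n) (l : Path n) (i : Fin n) (s : Bool)
    (hi : i ∉ c.map Prod.fst) : rem c (l ++ [(i, s)]) = rem c l := by
  have key : ∀ a ∈ c, a.1 ≠ i := fun a ha h => hi (h ▸ List.mem_map_of_mem ha)
  unfold rem
  have h1 : (∃ a ∈ c, (a.1, !a.2) ∈ l ++ [(i, s)]) ↔ ∃ a ∈ c, (a.1, !a.2) ∈ l := by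
    refine exists_congr fun a => and_congr_right fun ha => ?_
    simp [key a ha]
  have h2 : c.filter (fun a => a ∉ l ++ [(i, s)]) = c.filter (fun a => a ∉ l) := by
    refine List.filter_congr fun a ha => ?_
    have : a ≠ (i, s) := fun h => key a ha (by rw [h])
    simp [this]
  simp only [h1, h2]

theorem rem_concat_neg {n : ℕ} (c : Term n) (l : Path n) (i : Fin n) (s : Bool)
    (hi : (i, s) ∈ c) : rem c (l ++ [(i, !s)]) = none := by
  unfold rem
  rw [if_pos ⟨(i, s), hi, by simp⟩]

/-- Since `i` occurs once in `c` and not on the path, exactly one undecided literal becomes true.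
The second conclusion guarantees that the truncated subtraction in `down` is a real one. -/
theorem rem_concat_pos {n : ℕ} (c : Term n) (hc : (c.map Prod.fst).Nodup) (l : Path n) (i : Fin n)
    (s : Bool) (hi : (i, s) ∈ c) (hil : i ∉ l.map Prod.fst) :
    rem c (l ++ [(i, s)]) = down (rem c l) ∧ rem c l ≠ some 0 := by
  have hl : ∀ b, (i, b) ∉ l := fun b h => hil (List.mem_map_of_mem (f := Prod.fst) h)
  have key : ∀ a ∈ c, a.1 = i → a = (i, s) := fun a ha h =>
    List.inj_on_of_nodup_map hc ha hi h
  have h1 : (∃ a ∈ c, (a.1, !a.2) ∈ l ++ [(i, s)]) ↔ ∃ a ∈ c, (a.1, !a.2) ∈ l := by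
    refine exists_congr fun a => and_congr_right fun ha => ?_
    simp only [List.mem_append, List.mem_singleton, or_iff_left_iff_imp, Prod.mk.injEq, and_imp]
    intro h h'
    rw [key a ha h] at h'
    simp at h'
  have h2 : (c.filter (fun a => a ∉ l)).Perm ((i, s) :: c.filter (fun a => a ∉ l ++ [(i, s)])) := by
    have hnd : c.Nodup := hc.of_map
    rw [List.perm_ext_iff_of_nodup (hnd.filter _)
      (List.nodup_cons.2 ⟨by simp, hnd.filter _⟩)]
    intro a
    simp only [List.mem_filter, List.mem_cons, List.mem_append, decide_eq_true_eq, List.not_mem_nil]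
    by_cases ha : a = (i, s)
    · subst ha; simp [hi, hl]
    · simp [ha]
  have h3 := h2.length_eq
  unfold rem
  by_cases h : ∃ a ∈ c, (a.1, !a.2) ∈ l
  · rw [if_pos h, if_pos (h1.2 h)]; simp [down]
  · rw [if_neg h, if_neg (h1.not.2 h), h3]; simp [down]

theorem exists_of_rem_succ {n : ℕ} (c : Term n) (l : Path n) (k : ℕ) (h : rem c l = some (k + 1)) :
    ∃ i, i ∈ c.map Prod.fst ∧ i ∉ l.map Prod.fst := by
  unfold rem at h
  split_ifs at h with h1
  rw [Option.some_inj] at h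
  obtain ⟨a, ha⟩ := List.exists_mem_of_length_pos (l := c.filter fun a => a ∉ l) (by omega)
  simp only [List.mem_filter, decide_eq_true_eq] at ha
  refine ⟨a.1, List.mem_map_of_mem ha.1, fun hh => ?_⟩
  obtain ⟨⟨i, s⟩, hb, hb'⟩ := List.mem_map.1 hh
  obtain ⟨j, s'⟩ := a
  simp only at hb'
  subst hb'
  by_cases hs : s = s'
  · subst hs; exact ha.2 hb
  · refine h1 ⟨_, ha.1, ?_⟩
    have : s = !s' := by cases s <;> cases s' <;> simp_all
    rw [← this]; exact hb

theorem rem_nil {n : ℕ} (c : Term n) : rem c [] = some c.length := by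
  simp [rem]

theorem nodup_concat {n : ℕ} {l : Path n} (hl : (l.map Prod.fst).Nodup) {i : Fin n} (s : Bool)
    (hi : i ∉ l.map Prod.fst) : ((l ++ [(i, s)]).map Prod.fst).Nodup := by
  rw [List.map_append, List.map_singleton, ← List.concat_eq_append]
  exact hl.concat hi

end TopDownMIC

namespace TopDownMIC

/-! ### The lower bound for the error -/

/-- The least number of errors, on the cube of dimension `a + b`, of a tree with `t` internal nodes
for the disjunction of two disjoint conjunctions of `a ≤ b` literals. -/
noncomputable def leastErrors (a b t : ℕ) : ℝ :=
  if t + 1 < a then 2 ^ a + 2 ^ b - 1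
  else if t + 1 = a then 2 ^ a + 2 ^ b - 3
  else 2 ^ (a - (t - a) / b) - 1

theorem two_le_two_pow {k : ℕ} (hk : 1 ≤ k) : (2 : ℝ) ≤ 2 ^ k := by
  simpa using pow_le_pow_right₀ (one_le_two (α := ℝ)) hk

theorem two_pow_mono {k m : ℕ} (hk : k ≤ m) : (2 : ℝ) ^ k ≤ 2 ^ m :=
  pow_le_pow_right₀ one_le_two hk

theorem leastErrors_nonneg (a b t : ℕ) (hab : a ≤ b) : 0 ≤ leastErrors a b t := by
  unfold leastErrors
  have h2 := one_le_pow₀ (n := b) (one_le_two (α := ℝ))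
  have h3 := one_le_pow₀ (n := a) (one_le_two (α := ℝ))
  have h4 := one_le_pow₀ (n := a - (t - a) / b) (one_le_two (α := ℝ))
  split_ifs with h
  · linarith
  · have := two_le_two_pow (show 1 ≤ b by omega)
    linarith
  · linarith

theorem leastErrors_antitone {a b : ℕ} (hab : a ≤ b) : Antitone (leastErrors a b) := by
  refine antitone_nat_of_succ_le fun t => ?_
  unfold leastErrors
  have h2 := one_le_pow₀ (n := b) (one_le_two (α := ℝ))
  have h3 := one_le_pow₀ (n := a) (one_le_two (α := ℝ))
  rcases lt_trichotomy (t + 1) a with h | h | h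
  · rw [if_pos h]
    split_ifs <;> first | linarith | omega
  · have h4 := two_le_two_pow (show 1 ≤ b by omega)
    have h5 := two_pow_mono (Nat.sub_le a ((t + 1 - a) / b))
    rw [if_neg (by omega : ¬ t + 1 < a), if_pos h, if_neg (by omega), if_neg (by omega)]
    linarith
  · rw [if_neg (by omega), if_neg (by omega), if_neg (by omega), if_neg (by omega)]
    have : (t - a) / b ≤ (t + 1 - a) / b := Nat.div_le_div_right (by omega)
    have := two_pow_mono (Nat.sub_le_sub_left this a)
    linarith

/-- Bellman inequality for a test of the shorter term. In the child where that term fails, only the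
longer one is left; it has `2 ^ a` satisfying points there, which are charged unless `b` tests are
available. -/
theorem leastErrors_step_left (a b t t' : ℕ) (hab : a + 1 ≤ b) :
    leastErrors (a + 1) b (t + t' + 1) ≤ leastErrors a b t + if t' < b then 2 ^ a else 0 := by
  split_ifs with h
  -- By monotonicity it is enough to treat the smallest admissible `t'`: `0` here and `b` in the
  -- other case.
  · refine (leastErrors_antitone hab (show t + 1 ≤ t + t' + 1 by omega)).trans ?_
    unfold leastErrors
    rcases lt_trichotomy (t + 1) a with h | h | h
    · rw [if_pos (by omega), if_pos h, pow_succ]; linarith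
    · rw [if_neg (by omega), if_pos (by omega), if_neg (by omega), if_pos h, pow_succ]; linarith
    · rw [if_neg (by omega), if_neg (by omega), if_neg (by omega), if_neg (by omega)]
      rw [show t + 1 - (a + 1) = t - a by omega]
      rcases Nat.eq_zero_or_pos ((t - a) / b) with h | h
      · rw [h, Nat.sub_zero, Nat.sub_zero, pow_succ]; linarith
      · have h1 := two_pow_mono (show a + 1 - (t - a) / b ≤ a by omega)
        have h2 := one_le_pow₀ (n := a - (t - a) / b) (one_le_two (α := ℝ))
        linarith
  · refine (leastErrors_antitone hab (show t + b + 1 ≤ t + t' + 1 by omega)).trans ?_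
    unfold leastErrors
    rw [if_neg (by omega), if_neg (by omega)]
    by_cases h1 : t + 1 ≤ a
    · have h2 := two_pow_mono (Nat.sub_le (a + 1) ((t + b + 1 - (a + 1)) / b))
      have h3 := two_le_two_pow (show 1 ≤ a by omega)
      have h4 := two_pow_mono hab
      rw [pow_succ] at h2 h4
      split_ifs <;> first | linarith | omega
    · rw [if_neg (by omega), if_neg (by omega),
        show t + b + 1 - (a + 1) = t - a + b by omega, Nat.add_div_right _ (by omega),
        Nat.add_sub_add_right]
      simp

/-- The same for a test of the longer term: the child where it fails keeps the shorter term, with `2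
^ q` satisfying points and `p` tests needed to decide it. -/
theorem leastErrors_step_right (p q t t' : ℕ) (hpq : p ≤ q) :
    leastErrors p (q + 1) (t + t' + 1) ≤ leastErrors p q t + if t' < p then 2 ^ q else 0 := by
  have hpq' : p ≤ q + 1 := by omega
  split_ifs with h
  · refine (leastErrors_antitone hpq' (show t ≤ t + t' + 1 by omega)).trans ?_
    unfold leastErrors
    rcases lt_trichotomy (t + 1) p with h | h | h
    · rw [if_pos (by omega), if_pos h, pow_succ]; linarith
    · rw [if_neg (by omega), if_pos (by omega), if_neg (by omega), if_pos h, pow_succ]; linarith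
    · rw [if_neg (by omega), if_neg (by omega), if_neg (by omega), if_neg (by omega)]
      have h1 := two_pow_mono ((Nat.sub_le p ((t - p) / (q + 1))).trans hpq)
      have h2 := one_le_pow₀ (n := p - (t - p) / q) (one_le_two (α := ℝ))
      linarith
  · refine (leastErrors_antitone hpq' (show t + p + 1 ≤ t + t' + 1 by omega)).trans ?_
    unfold leastErrors
    rw [if_neg (by omega), if_neg (by omega)]
    by_cases h1 : t + 1 ≤ p
    · have h2 := two_pow_mono (Nat.sub_le p ((t + p + 1 - p) / (q + 1)))
      have h3 := two_le_two_pow (show 1 ≤ q by omega)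
      split_ifs <;> first | linarith | omega
    · rw [if_neg (by omega), if_neg (by omega), show t + p + 1 - p = t + 1 by omega]
      suffices p - (t + 1) / (q + 1) ≤ p - (t - p) / q by
        have := two_pow_mono this
        linarith
      -- With `M = (t + 1) / (q + 1) ≤ p`, the bound `t + 1 < (M + 1) * (q + 1)` gives `t - p < (M +
      -- 1) * q`. If `M > p`, the left side is `0` by truncation.
      by_cases h2 : (t + 1) / (q + 1) ≤ p
      · refine Nat.sub_le_sub_left ?_ p
        rcases Nat.eq_zero_or_pos q with hq | hq
        · simp [hq]
        · rw [← Nat.lt_succ_iff, Nat.div_lt_iff_lt_mul hq]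
          have h3 := Nat.lt_mul_of_div_lt (Nat.lt_succ_self ((t + 1) / (q + 1))) (Nat.succ_pos q)
          rw [Nat.succ_eq_add_one] at *
          generalize (t + 1) / (q + 1) = M at *
          have : (M + 1) * (q + 1) = (M + 1) * q + M + 1 := by ring
          rw [Nat.mul_comm] at h3
          have : (q + 1) * (M + 1) = (M + 1) * q + M + 1 := by ring
          omega
      · omega

/-- A lower bound for the conditional error of a tree with `t` internal nodes, given the numbers of
undecided literals of the two terms. -/
noncomputable def errorBound : Option ℕ → Option ℕ → ℕ → ℝ
  | none, none, _ => 0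
  | none, some k, t => if t < k then (1 / 2) ^ k else 0
  | some k, none, t => if t < k then (1 / 2) ^ k else 0
  | some a, some b, t => (1 / 2) ^ (a + b) * leastErrors (min a b) (max a b) t

theorem errorBound_comm (r s : Option ℕ) (t : ℕ) : errorBound r s t = errorBound s r t := by
  cases r <;> cases s <;> simp only [errorBound]
  rw [add_comm, min_comm, max_comm]

theorem errorBound_antitone (r s : Option ℕ) : Antitone (errorBound r s) := by
  intro t t' h
  cases r <;> cases s <;> simp only [errorBound]
  · rfl
  · split_ifs <;> first | omega | positivity | rfl
  · split_ifs <;> first | omega | positivity | rfl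
  · exact mul_le_mul_of_nonneg_left (leastErrors_antitone min_le_max h) (by positivity)

theorem val_nonneg (r : Option ℕ) : 0 ≤ val r := by
  cases r <;> simp only [val] <;> positivity

theorem val_le_one (r : Option ℕ) : val r ≤ 1 := by
  cases r <;> simp only [val]
  · norm_num
  · exact pow_le_one₀ (by norm_num) (by norm_num)

/-- The base case of the induction on trees: a leaf errs with conditional probability `q` or `1 -
q`, according to its label. -/
theorem errorBound_zero_le (r s : Option ℕ) :
    errorBound r s 0 ≤ orProb (val r) (val s) ∧ errorBound r s 0 ≤ 1 - orProb (val r) (val s) := by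
  have key : ∀ k : ℕ, (if 0 < k then (1 / 2 : ℝ) ^ k else 0) ≤ (1 / 2) ^ k ∧
      (if 0 < k then (1 / 2 : ℝ) ^ k else 0) ≤ 1 - (1 / 2) ^ k := by
    intro k
    split_ifs with h
    · have : (1 / 2 : ℝ) ^ k ≤ 1 / 2 := by
        simpa using pow_le_pow_of_le_one (by norm_num) (by norm_num : (1 / 2 : ℝ) ≤ 1) h
      constructor <;> linarith
    · obtain rfl : k = 0 := by omega
      norm_num
  have main : ∀ a b : ℕ, a ≤ b → (1 / 2) ^ (a + b) * leastErrors a b 0 ≤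
      orProb (val (some a)) (val (some b)) ∧
      (1 / 2) ^ (a + b) * leastErrors a b 0 ≤ 1 - orProb (val (some a)) (val (some b)) := by
    intro a b hab
    simp only [val, orProb]
    have h1 : (1 / 2 : ℝ) ^ a * 2 ^ a = 1 := by rw [← mul_pow]; norm_num
    have h2 : (1 / 2 : ℝ) ^ b * 2 ^ b = 1 := by rw [← mul_pow]; norm_num
    have h3 : 0 ≤ (1 / 2 : ℝ) ^ a := by positivity
    have h4 : 0 ≤ (1 / 2 : ℝ) ^ b := by positivity
    rw [pow_add]
    unfold leastErrors
    split_ifs with h h'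
    · have h5 : (1 / 2 : ℝ) ^ a ≤ (1 / 2) ^ 2 :=
        pow_le_pow_of_le_one (by norm_num) (by norm_num) (by omega)
      have h6 : (1 / 2 : ℝ) ^ b ≤ (1 / 2) ^ 2 :=
        pow_le_pow_of_le_one (by norm_num) (by norm_num) (by omega)
      have h7 : (1 / 2 : ℝ) ^ a * (1 / 2) ^ b * (2 ^ a + 2 ^ b - 1) =
          (1 / 2) ^ a + (1 / 2) ^ b - (1 / 2) ^ a * (1 / 2) ^ b := by
        linear_combination (1 / 2 : ℝ) ^ b * h1 + (1 / 2 : ℝ) ^ a * h2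
      rw [h7]
      have := mul_nonneg h3 h4
      constructor <;> linarith
    · obtain rfl : a = 1 := by omega
      have h7 : (1 / 2 : ℝ) ^ 1 * (1 / 2) ^ b * (2 ^ 1 + 2 ^ b - 3) =
          1 / 2 - 1 / 2 * (1 / 2) ^ b := by
        linear_combination (1 / 2 : ℝ) * h2
      rw [h7]
      constructor <;> linarith
    · obtain rfl : a = 0 := by omega
      simp
  cases r with
  | none =>
    cases s with
    | none => simp [errorBound, orProb, val]
    | some k => simpa [errorBound, orProb, val] using key k
  | some a =>
    cases s with
    | none => simpa [errorBound, orProb, val] using key a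
    | some b =>
      rcases le_total a b with h | h
      · simpa [errorBound, h] using main a b h
      · have := main b a h
        have h1 : orProb (val (some a)) (val (some b)) = orProb (val (some b)) (val (some a)) := by
          unfold orProb; ring
        rw [h1, errorBound_comm]
        simpa [errorBound, h] using this

/-- The Bellman inequality in terms of conditional errors. The factor `2` appears because the error
at a node is the average over its two children. -/
theorem errorBound_step (r s : Option ℕ) (hr : r ≠ some 0) (t t' : ℕ) :
    2 * errorBound r s (t + t' + 1) ≤ errorBound (down r) s t + errorBound none s t' := by
  cases r with
  | none =>
    have h1 := errorBound_antitone none s (show t ≤ t + t' + 1 by omega)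
    have h2 := errorBound_antitone none s (show t' ≤ t + t' + 1 by omega)
    simp only [down]
    linarith
  | some a =>
    obtain ⟨a, rfl⟩ : ∃ k, a = k + 1 :=
      Nat.exists_eq_succ_of_ne_zero fun h : a = 0 => hr (by rw [h])
    simp only [down, Nat.add_sub_cancel]
    cases s with
    | none =>
      simp only [errorBound]
      split_ifs
      · rw [pow_succ]; linarith
      · omega
      · rw [mul_zero, add_zero]; positivity
      · simp
    | some b =>
      simp only [errorBound]
      have h2 : (1 / 2 : ℝ) ^ a * 2 ^ a = 1 := by rw [← mul_pow]; norm_num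
      have h3 : (if t' < b then (1 / 2 : ℝ) ^ b else 0) =
          (1 / 2) ^ (a + b) * if t' < b then 2 ^ a else 0 := by
        split_ifs
        · rw [pow_add]; linear_combination -(1 / 2 : ℝ) ^ b * h2
        · simp
      have h4 : 2 * ((1 / 2 : ℝ) ^ (a + 1 + b)) = (1 / 2) ^ (a + b) := by ring
      rw [h3, ← mul_add, ← mul_assoc, h4]
      refine mul_le_mul_of_nonneg_left ?_ (by positivity)
      rcases Nat.lt_or_ge a b with h | h
      · rw [min_eq_left (by omega), max_eq_right (by omega), min_eq_left (by omega),
          max_eq_right (by omega)]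
        exact leastErrors_step_left a b t t' h
      · rw [min_eq_right (by omega), max_eq_left (by omega), min_eq_right (by omega),
          max_eq_left (by omega)]
        exact leastErrors_step_right b a t t' h

/-- The probability of reaching the node `l` and then making an error with the tree `T`. -/
noncomputable def errAt {n : ℕ} (f : (Fin n → Bool) → Bool) (l : Path n) (T : DTree n) : ℝ :=
  pr fun x => Term.Holds l x ∧ T.eval x ≠ f x

/-! ### The error of a tree below a node -/

theorem rem_concat_cases {n : ℕ} (c : Term n) (hc : (c.map Prod.fst).Nodup) (l : Path n) (i : Fin n)
    (hil : i ∉ l.map Prod.fst) :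
    (i ∉ c.map Prod.fst ∧ ∀ s, rem c (l ++ [(i, s)]) = rem c l) ∨
    (i ∈ c.map Prod.fst ∧ rem c l ≠ some 0 ∧ ∃ s, rem c (l ++ [(i, s)]) = down (rem c l) ∧
      rem c (l ++ [(i, !s)]) = none) := by
  by_cases hi : i ∈ c.map Prod.fst
  · right
    obtain ⟨⟨j, s⟩, ha, rfl⟩ := List.mem_map.1 hi
    have := rem_concat_pos c hc l j s ha hil
    exact ⟨hi, this.2, s, this.1, rem_concat_neg c l j s ha⟩
  · exact Or.inl ⟨hi, fun s => rem_concat_of_notMem c l i s hi⟩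

theorem errAt_node {n : ℕ} (f : (Fin n → Bool) → Bool) (l : Path n) (i : Fin n) (t₀ t₁ : DTree n) :
    errAt f l (.node i t₀ t₁) = errAt f (l ++ [(i, false)]) t₀ + errAt f (l ++ [(i, true)]) t₁ := by
  refine pr_add _ _ _ ?_ ?_
  · rintro x ⟨⟨h, -⟩, h', -⟩
    rw [holds_concat] at h h'
    have := h.2.symm.trans h'.2
    simp at this
  · intro x
    simp only [holds_concat, DTree.eval]
    cases x i <;> simp

theorem errAt_node_of_mem {n : ℕ} (f : (Fin n → Bool) → Bool) (l : Path n) (i : Fin n) (s : Bool)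
    (t₀ t₁ : DTree n) (h : (i, s) ∈ l) :
    errAt f l (.node i t₀ t₁) = errAt f l (if s then t₁ else t₀) := by
  refine pr_congr fun x => and_congr_right fun hx => ?_
  have := hx _ h
  simp only at this
  simp only [DTree.eval, this]
  cases s <;> simp

theorem TwoTerm.pr_eq_false {n : ℕ} {f : (Fin n → Bool) → Bool} {c d : Term n}
    (h : TwoTerm f c d) (l : Path n) (hl : (l.map Prod.fst).Nodup) :
    pr (fun x => Term.Holds l x ∧ f x = false) =
      (1 / 2) ^ l.length * (1 - orProb (val (rem c l)) (val (rem d l))) := by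
  have h1 := pr_add (fun x => Term.Holds l x ∧ f x = true) (fun x => Term.Holds l x ∧ f x = false)
    (Term.Holds l) (by rintro x ⟨⟨-, h⟩, -, h'⟩; rw [h] at h'; simp at h')
    (by intro x; cases f x <;> simp)
  rw [pr_holds l hl, h.pr_true l hl] at h1
  linarith

theorem errAt_leaf_true {n : ℕ} {f : (Fin n → Bool) → Bool} {c d : Term n}
    (h : TwoTerm f c d) (l : Path n) (hl : (l.map Prod.fst).Nodup) :
    errAt f l (.leaf true) =
      (1 / 2) ^ l.length * (1 - orProb (val (rem c l)) (val (rem d l))) := by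
  rw [← h.pr_eq_false l hl]
  refine pr_congr fun x => ?_
  cases hx : f x <;> simp [DTree.eval]

theorem errAt_leaf_false {n : ℕ} {f : (Fin n → Bool) → Bool} {c d : Term n}
    (h : TwoTerm f c d) (l : Path n) (hl : (l.map Prod.fst).Nodup) :
    errAt f l (.leaf false) = (1 / 2) ^ l.length * orProb (val (rem c l)) (val (rem d l)) := by
  rw [← h.pr_true l hl]
  refine pr_congr fun x => ?_
  simp [DTree.eval]

theorem errorBound_le_errAt {n : ℕ} {f : (Fin n → Bool) → Bool} {c d : Term n}
    (h : TwoTerm f c d) (T : DTree n) (l : Path n) (hl : (l.map Prod.fst).Nodup) :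
    (1 / 2) ^ l.length * errorBound (rem c l) (rem d l) T.size ≤ errAt f l T := by
  induction T generalizing l with
  | leaf b =>
    have h0 := errorBound_zero_le (rem c l) (rem d l)
    cases b
    · rw [errAt_leaf_false h l hl]
      exact mul_le_mul_of_nonneg_left h0.1 (by positivity)
    · rw [errAt_leaf_true h l hl]
      exact mul_le_mul_of_nonneg_left h0.2 (by positivity)
  | node i t₀ t₁ ih₀ ih₁ =>
    by_cases hil : i ∈ l.map Prod.fst
    · obtain ⟨⟨j, s⟩, ha, rfl⟩ := List.mem_map.1 hil
      rw [errAt_node_of_mem f l j s t₀ t₁ ha]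
      -- The variable is already fixed on the path, so only one subtree is ever used; its size is
      -- smaller and `errorBound` is antitone.
      cases s
      · refine le_trans (mul_le_mul_of_nonneg_left ?_ (by positivity)) (ih₀ l hl)
        exact errorBound_antitone _ _ (by simp only [DTree.size]; omega)
      · refine le_trans (mul_le_mul_of_nonneg_left ?_ (by positivity)) (ih₁ l hl)
        exact errorBound_antitone _ _ (by simp only [DTree.size]; omega)
    · rw [errAt_node]
      have h0 := ih₀ _ (nodup_concat hl false hil)
      have h1 := ih₁ _ (nodup_concat hl true hil)
      refine le_trans ?_ (add_le_add h0 h1)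
      simp only [List.length_append, List.length_singleton, DTree.size]
      rw [pow_succ, ← mul_add, mul_assoc]
      refine mul_le_mul_of_nonneg_left ?_ (by positivity)
      have key1 := rem_concat_cases c h.nodup_left l i hil
      have key2 := rem_concat_cases d h.symm.nodup_left l i hil
      rcases key1 with ⟨-, e1⟩ | ⟨hi, hr, s, e1, e1'⟩
      · rw [e1, e1]
        rcases key2 with ⟨-, e2⟩ | ⟨-, hr, s, e2, e2'⟩
        · rw [e2, e2]
          -- A variable of neither term: both children have the type of the parent, and monotonicity
          -- suffices.
          have a1 := errorBound_antitone (rem c l) (rem d l)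
            (show t₀.size ≤ t₀.size + t₁.size + 1 by omega)
          have a2 := errorBound_antitone (rem c l) (rem d l)
            (show t₁.size ≤ t₀.size + t₁.size + 1 by omega)
          linarith
        · rw [errorBound_comm (rem c l) (rem d l), errorBound_comm (rem c l) _ t₀.size,
            errorBound_comm (rem c l) _ t₁.size]
          cases s
          · have := errorBound_step (rem d l) (rem c l) hr t₀.size t₁.size
            simp only [Bool.not_false] at e2'
            rw [e2, e2']; linarith
          · have := errorBound_step (rem d l) (rem c l) hr t₁.size t₀.size
            simp only [Bool.not_true] at e2'
            rw [e2, e2', add_comm t₀.size]; linarith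
      · rcases key2 with ⟨-, e2⟩ | ⟨hi', -⟩
        · rw [e2, e2]
          cases s
          · have := errorBound_step (rem c l) (rem d l) hr t₀.size t₁.size
            simp only [Bool.not_false] at e1'
            rw [e1, e1']; linarith
          · have := errorBound_step (rem c l) (rem d l) hr t₁.size t₀.size
            simp only [Bool.not_true] at e1'
            rw [e1, e1', add_comm t₀.size]; linarith
        · exact (h.disjoint hi hi').elim

end TopDownMIC

namespace TopDownMIC

/-! ### Entropy decrease of splits -/
open Real Set

theorem entropy_eq (x : ℝ) : entropy x = binEntropy x / log 2 := by
  rw [binEntropy_eq_negMulLog_add_negMulLog_one_sub]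
  simp only [entropy, logb, negMulLog]
  ring

/-- The entropy decrease, up to the factor `log 2`, of the split on a variable of a conjunction of
probability `u`, in the disjunction with an independent event of probability `v`. -/
noncomputable def splitGain (u v : ℝ) : ℝ :=
  binEntropy (orProb u v) - binEntropy v / 2 - binEntropy (orProb (2 * u) v) / 2

/-- The Jensen gap of `negMulLog` at `1 + r` for the points `1` and `1 + 2 * r`. -/
noncomputable def jensenGap (r : ℝ) : ℝ := negMulLog (1 + r) - negMulLog (1 + 2 * r) / 2

theorem continuous_jensenGap : Continuous jensenGap := by
  unfold jensenGap
  have := continuous_negMulLog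
  fun_prop

theorem hasDerivAt_jensenGap {r : ℝ} (h : -1 / 2 < r) :
    HasDerivAt jensenGap (log (1 + 2 * r) - log (1 + r)) r := by
  have h1 := (hasDerivAt_negMulLog (show 1 + r ≠ 0 by linarith)).comp r
    ((hasDerivAt_id r).const_add 1)
  have h2 := (hasDerivAt_negMulLog (show 1 + 2 * r ≠ 0 by linarith)).comp r
    (((hasDerivAt_id r).const_mul 2).const_add 1)
  exact (h1.sub (h2.div_const 2)).congr_deriv (by ring)

theorem jensenGap_zero : jensenGap 0 = 0 := by simp [jensenGap]

/-- Relative to the child where the tested term fails, with probabilities `v` and `1 - v`, the other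
values are multiples of `v` and of `1 - v`. By `negMulLog_mul` the parts linear in the scale cancel,
and only Jensen gaps at `1` remain. -/
theorem splitGain_eq {u v : ℝ} (hv : v ≠ 0) :
    splitGain u v = (1 - v) * jensenGap (-u) + v * jensenGap (u * (1 - v) / v) := by
  have e1 : orProb u v = v * (1 + u * (1 - v) / v) := by unfold orProb; field_simp; ring
  have e2 : orProb (2 * u) v = v * (1 + 2 * (u * (1 - v) / v)) := by
    unfold orProb; field_simp; ring
  have e3 : 1 - orProb u v = (1 - v) * (1 + -u) := by unfold orProb; ring
  have e4 : 1 - orProb (2 * u) v = (1 - v) * (1 + 2 * -u) := by unfold orProb; ring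
  simp only [splitGain, binEntropy_eq_negMulLog_add_negMulLog_one_sub, e3, e4]
  rw [e1, e2]
  simp only [negMulLog_mul, jensenGap]
  ring

theorem splitGain_zero_right {v : ℝ} (hv : v ≠ 0) :
    splitGain v 0 = v * log 2 + jensenGap (-v) := by
  simp only [splitGain, binEntropy_eq_negMulLog_add_negMulLog_one_sub, orProb, negMulLog,
    jensenGap, mul_zero, add_zero, sub_zero, log_zero, log_one, log_mul two_ne_zero hv]
  have e3 : 1 - 2 * v = 1 + 2 * -v := by ring
  rw [e3]
  ring_nf

/-- The derivative of `jensenGap (-x)` is `log ((1 - x) / (1 - 2 * x))`, which is at least `x`. The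
next lemma integrates the upper bound `x / (1 - 2 * x)`. -/
theorem sq_div_two_le_jensenGap_neg {u : ℝ} (h0 : 0 ≤ u) (h1 : u ≤ 1 / 2) :
    u ^ 2 / 2 ≤ jensenGap (-u) := by
  have key : MonotoneOn (fun x => jensenGap (-x) - x ^ 2 / 2) (Icc 0 (1 / 2)) := by
    refine monotoneOn_of_hasDerivWithinAt_nonneg (convex_Icc _ _)
      (f' := fun x => (log (1 + 2 * -x) - log (1 + -x)) * (-1) - x) ?_ ?_ ?_
    · have := continuous_jensenGap
      fun_prop
    · intro x hx
      rw [interior_Icc] at hx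
      have := ((hasDerivAt_jensenGap (r := -x) (by linarith [hx.2])).comp x
        (hasDerivAt_neg x)).sub (((hasDerivAt_id x).pow 2).div_const 2)
      refine HasDerivAt.hasDerivWithinAt (this.congr_deriv ?_)
      simp
    · intro x hx
      rw [interior_Icc] at hx
      obtain ⟨hx0, hx1⟩ := hx
      have h2 : log ((1 + 2 * -x) / (1 + -x)) ≤ (1 + 2 * -x) / (1 + -x) - 1 :=
        log_le_sub_one_of_pos (div_pos (by linarith) (by linarith))
      rw [log_div (by linarith) (by linarith)] at h2
      have h3 : (1 + 2 * -x) / (1 + -x) - 1 ≤ -x := by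
        rw [sub_le_iff_le_add, div_le_iff₀ (by linarith)]
        nlinarith
      linarith
  have := key (left_mem_Icc.2 (by norm_num)) (mem_Icc.2 ⟨h0, h1⟩) h0
  simp only [neg_zero, jensenGap_zero] at this
  linarith

theorem jensenGap_neg_le {v w : ℝ} (h0 : 0 ≤ v) (h1 : v ≤ w) (h2 : w < 1 / 2) :
    jensenGap (-v) ≤ v ^ 2 / (2 * (1 - 2 * w)) := by
  have hw : 0 < 1 - 2 * w := by linarith
  have key : MonotoneOn (fun x => x ^ 2 / (2 * (1 - 2 * w)) - jensenGap (-x)) (Icc 0 w) := by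
    refine monotoneOn_of_hasDerivWithinAt_nonneg (convex_Icc _ _)
      (f' := fun x => x / (1 - 2 * w) - (log (1 + 2 * -x) - log (1 + -x)) * (-1)) ?_ ?_ ?_
    · have := continuous_jensenGap
      fun_prop
    · intro x hx
      rw [interior_Icc] at hx
      have := (((hasDerivAt_id x).pow 2).div_const (2 * (1 - 2 * w))).sub
        ((hasDerivAt_jensenGap (r := -x) (by linarith [hx.2])).comp x (hasDerivAt_neg x))
      refine HasDerivAt.hasDerivWithinAt (this.congr_deriv ?_)
      simp
      field_simp
    · intro x hx
      rw [interior_Icc] at hx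
      obtain ⟨hx0, hx1⟩ := hx
      have hx2 : 0 < 1 + 2 * -x := by linarith
      have h2 : log ((1 + -x) / (1 + 2 * -x)) ≤ (1 + -x) / (1 + 2 * -x) - 1 :=
        log_le_sub_one_of_pos (div_pos (by linarith) hx2)
      rw [log_div (by linarith) (by linarith)] at h2
      have h3 : (1 + -x) / (1 + 2 * -x) - 1 = x / (1 + 2 * -x) := by
        rw [div_sub_one hx2.ne']; congr 1; ring
      have h4 : x / (1 + 2 * -x) ≤ x / (1 - 2 * w) := by gcongr; linarith
      linarith
  have := key (left_mem_Icc.2 (h0.trans h1)) (mem_Icc.2 ⟨h0, h1⟩) h0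
  simp only [neg_zero, jensenGap_zero] at this
  norm_num at this
  exact this

theorem hasDerivAt_jensenGap_div {r : ℝ} (h : 0 < r) :
    HasDerivAt (fun r => jensenGap r / r) ((log (1 + r) - log (1 + 2 * r) / 2) / r ^ 2) r := by
  have h1 := (hasDerivAt_jensenGap (r := r) (by linarith)).div (hasDerivAt_id r) h.ne'
  refine h1.congr_deriv ?_
  simp only [id, jensenGap, negMulLog]
  congr 1
  ring

theorem log_one_add_two_mul_le {r : ℝ} (h : 0 < r) : log (1 + 2 * r) ≤ 2 * log (1 + r) := by
  rw [two_mul (log _), ← log_mul (by positivity) (by positivity)]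
  exact log_le_log (by positivity) (by nlinarith)

theorem jensenGap_div_mono {r s : ℝ} (hr : 0 < r) (h : r ≤ s) : jensenGap r / r ≤ jensenGap s / s := by
  have key : MonotoneOn (fun r => jensenGap r / r) (Icc r s) := by
    refine monotoneOn_of_hasDerivWithinAt_nonneg (convex_Icc _ _)
      (f' := fun r => (log (1 + r) - log (1 + 2 * r) / 2) / r ^ 2) ?_ ?_ ?_
    · intro x hx
      exact (hasDerivAt_jensenGap_div (hr.trans_le hx.1)).continuousAt.continuousWithinAt
    · intro x hx
      rw [interior_Icc] at hx
      exact (hasDerivAt_jensenGap_div (hr.trans hx.1)).hasDerivWithinAt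
    · intro x hx
      rw [interior_Icc] at hx
      have := log_one_add_two_mul_le (hr.trans hx.1)
      exact div_nonneg (by linarith) (by positivity)
  exact key (left_mem_Icc.2 h) (right_mem_Icc.2 h) h

/-- The quotient has slope at most `1 / 8`: by `log y ≤ y - 1` the slope is at most `1 / (2 * (1 + 2
* r))`, and `1 + 2 * r ≥ 4`. -/
theorem le_jensenGap_div {r s : ℝ} (hr : 3 / 2 ≤ r) (h : r ≤ s) :
    jensenGap s / s - (s - r) / 8 ≤ jensenGap r / r := by
  have key : MonotoneOn (fun r => r / 8 - jensenGap r / r) (Icc r s) := by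
    refine monotoneOn_of_hasDerivWithinAt_nonneg (convex_Icc _ _)
      (f' := fun r => 1 / 8 - (log (1 + r) - log (1 + 2 * r) / 2) / r ^ 2) ?_ ?_ ?_
    · intro x hx
      have hx0 : 0 < x := by linarith [hx.1]
      exact (((hasDerivAt_id x).div_const 8).sub
        (hasDerivAt_jensenGap_div hx0)).continuousAt.continuousWithinAt
    · intro x hx
      rw [interior_Icc] at hx
      have hx0 : 0 < x := by linarith [hx.1]
      exact (((hasDerivAt_id x).div_const 8).sub (hasDerivAt_jensenGap_div hx0)).hasDerivWithinAt
    · intro x hx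
      rw [interior_Icc] at hx
      have hx0 : 3 / 2 < x := by linarith [hx.1]
      have h1 : log ((1 + x) ^ 2 / (1 + 2 * x)) ≤ (1 + x) ^ 2 / (1 + 2 * x) - 1 :=
        log_le_sub_one_of_pos (by positivity)
      rw [log_div (by positivity) (by positivity), log_pow] at h1
      have h2 : (1 + x) ^ 2 / (1 + 2 * x) - 1 ≤ x ^ 2 / 4 := by
        rw [sub_le_iff_le_add, div_le_iff₀ (by positivity)]
        nlinarith [sq_nonneg x, mul_pos (show 0 < x by linarith) (show 0 < x by linarith)]
      push_cast at h1
      rw [sub_nonneg, div_le_iff₀ (by positivity)]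
      linarith
  have := key (left_mem_Icc.2 h) (right_mem_Icc.2 h) h
  simp only at this
  linarith

/-- The exact value is `(log (3125 / 2916) + 2 * log 2) / 4`. What matters is that it exceeds `log 2
/ 2`, the limiting value needed as `v → 0`. -/
theorem jensenGap_two : 0.363 ≤ jensenGap 2 / 2 := by
  have h1 : log (3125 / 2916) = 5 * log 5 - 2 * log 2 - 6 * log 3 := by
    rw [log_div (by norm_num) (by norm_num), show (3125 : ℝ) = 5 ^ 5 by norm_num,
      show (2916 : ℝ) = 2 ^ 2 * 3 ^ 6 by norm_num, log_mul (by norm_num) (by norm_num), log_pow,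
      log_pow, log_pow]
    push_cast
    ring
  have h2 := one_sub_inv_le_log_of_pos (show (0 : ℝ) < 3125 / 2916 by norm_num)
  have h3 := log_two_gt_d9
  rw [h1] at h2
  unfold jensenGap negMulLog
  norm_num at h2 ⊢
  linarith

/-- Splitting on the shorter conjunction beats any split in a finished branch. -/
theorem splitGain_zero_right_lt_of_le_eighth {u v : ℝ} (hv : 0 < v) (hv' : v ≤ 1 / 8)
    (huv : 2 * v ≤ u) (hu : u ≤ 1 / 2) : splitGain v 0 / 2 < v / u * splitGain u v := by
  have hu0 : 0 < u := by linarith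
  set r := u * (1 - v) / v with hr
  have hr1 : 2 - 2 * v ≤ r := by
    rw [hr, le_div_iff₀ hv]
    nlinarith
  have hr0 : 0 < r := by linarith
  -- As `r ≥ 2 - 2 * v`, the value at `r` falls below that at `2` by at most `2 * v / 8`.
  have h1 : 0.363 - v / 4 ≤ jensenGap r / r := by
    have h2 := jensenGap_two
    rcases le_total r 2 with h | h
    · have := le_jensenGap_div (r := r) (s := 2) (by linarith) h
      linarith
    · have := jensenGap_div_mono two_pos h
      linarith
  have h2 : v / u * splitGain u v =
      (1 - v) * v * (jensenGap (-u) / u + jensenGap r / r) := by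
    rw [splitGain_eq hv.ne', ← hr]
    have : 1 - v ≠ 0 := by linarith
    have e : jensenGap r / r = jensenGap r * v / (u * (1 - v)) := by
      rw [hr]; field_simp
    rw [e]
    field_simp
  have h3 : v ≤ jensenGap (-u) / u := by
    have := sq_div_two_le_jensenGap_neg hu0.le hu
    rw [le_div_iff₀ hu0]
    nlinarith
  have h4 := jensenGap_neg_le hv.le hv' (by norm_num)
  have h5 := log_two_lt_d9
  rw [h2, splitGain_zero_right hv.ne']
  have h6 : (1 - v) * v * (0.363 + 3 / 4 * v) ≤
      (1 - v) * v * (jensenGap (-u) / u + jensenGap r / r) :=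
    mul_le_mul_of_nonneg_left (by linarith) (mul_nonneg (by linarith) hv.le)
  refine lt_of_lt_of_le ?_ h6
  have h7 : v * log 2 + jensenGap (-v) ≤ v * (0.6931471808 + 2 / 3 * v) := by
    have : v * log 2 ≤ v * 0.6931471808 := by gcongr
    norm_num at h4
    nlinarith
  -- The summand `3 / 4 * v` is `v - v / 4`, from `h3` and `h1`; `2 / 3` is `1 / (2 * (1 - 2 / 8))`,
  -- from `h4`. The inequality holds on `[0, 1/8]`.
  have h8 : (0.6931471808 + 2 / 3 * v) / 2 < (1 - v) * (0.363 + 3 / 4 * v) := by nlinarith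
  have h9 := mul_lt_mul_of_pos_left h8 hv
  linarith

/-- The case `a = b = 2`, which the estimate for `v ≤ 1 / 8` misses. The difference of the two sides
is `log (11664 / 3125) / 16`. -/
theorem splitGain_quarter : splitGain (1 / 4) 0 / 2 < (1 / 4) / (1 / 2) * splitGain (1 / 2) (1 / 4) := by
  rw [splitGain_zero_right (by norm_num), splitGain_eq (by norm_num)]
  have h1 : log (11664 / 3125) = 4 * log 2 + 6 * log 3 - 5 * log 5 := by
    rw [log_div (by norm_num) (by norm_num), show (3125 : ℝ) = 5 ^ 5 by norm_num,
      show (11664 : ℝ) = 2 ^ 4 * 3 ^ 6 by norm_num, log_mul (by norm_num) (by norm_num), log_pow,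
      log_pow, log_pow]
    push_cast
    ring
  have h2 : 0 < log (11664 / 3125) := log_pos (by norm_num)
  have e1 : log (5 / 2) = log 5 - log 2 := log_div (by norm_num) (by norm_num)
  have e2 : log (3 / 4) = log 3 - 2 * log 2 := by
    rw [log_div (by norm_num) (by norm_num), show (4 : ℝ) = 2 ^ 2 by norm_num, log_pow]; norm_num
  have e3 : log 4 = 2 * log 2 := by
    rw [show (4 : ℝ) = 2 ^ 2 by norm_num, log_pow]; norm_num
  have e4 : log (1 / 2) = - log 2 := by rw [one_div, log_inv]
  unfold jensenGap negMulLog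
  rw [h1] at h2
  norm_num [e1, e2, e3, e4]
  linarith

theorem mul_log_two_lt_splitGain {v : ℝ} (h0 : 0 < v) (h1 : v ≤ 1 / 2) :
    v * log 2 < splitGain v 0 := by
  rw [splitGain_zero_right h0.ne']
  have := sq_div_two_le_jensenGap_neg h0.le h1
  nlinarith

/-- Together with the preceding lower bound this pins the gain down to a factor `2`, just what the
extra level of depth of the next branch compensates. Equality holds at `v = 1 / 2`. -/
theorem splitGain_zero_right_le {v : ℝ} (h0 : 0 < v) (h1 : v ≤ 1 / 4 ∨ v = 1 / 2) :
    splitGain v 0 ≤ 2 * (v * log 2) := by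
  rw [splitGain_zero_right h0.ne']
  rcases h1 with h1 | rfl
  · have h2 := jensenGap_neg_le h0.le h1 (by norm_num)
    have h3 := log_two_gt_d9
    norm_num at h2
    nlinarith
  · have : log (1 / 2) = - log 2 := by rw [one_div, log_inv]
    unfold jensenGap negMulLog
    norm_num [this]
    linarith

theorem splitGain_pos {u v : ℝ} (hu : 0 < u) (hu' : u ≤ 1 / 2) (hv : 0 ≤ v) (hv' : v < 1) :
    0 < splitGain u v := by
  have hX : v ∈ Icc (0 : ℝ) 1 := ⟨hv, hv'.le⟩
  have hY : orProb (2 * u) v ∈ Icc (0 : ℝ) 1 :=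
    ⟨by unfold orProb; nlinarith, by unfold orProb; nlinarith⟩
  have hne : v ≠ orProb (2 * u) v := by unfold orProb; intro h; nlinarith
  have h := strictConcave_binEntropy.2 hX hY hne one_half_pos one_half_pos (by norm_num)
  have e : (1 / 2 : ℝ) • v + (1 / 2 : ℝ) • orProb (2 * u) v = orProb u v := by
    simp only [smul_eq_mul, orProb]; ring
  rw [e] at h
  simp only [smul_eq_mul] at h
  unfold splitGain
  linarith

/-- It is better to split on the more probable conjunction. -/
theorem splitGain_lt_splitGain {u v : ℝ} (hv : 0 < v) (huv : v < u) (hu : u ≤ 1 / 2) :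
    splitGain v u < splitGain u v := by
  have hq : 0 < 2 * u * (1 - v) := by nlinarith
  -- On the segment from `v` to `orProb (2 * u) v` the points `u` and `orProb (2 * v) u` have
  -- parameters `s` and `1 - s`. Adding the two concavity inequalities shows that the inner pair has
  -- the larger total entropy.
  obtain ⟨s, hs⟩ : ∃ s, s * (2 * u * (1 - v)) = u - v := ⟨_, div_mul_cancel₀ _ hq.ne'⟩
  have hs0 : 0 < s := by
    by_contra h
    nlinarith
  have hs1 : s < 1 := by
    by_contra h
    have : 2 * u * (1 - v) ≤ s * (2 * u * (1 - v)) := by nlinarith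
    nlinarith
  have hY : orProb (2 * u) v ∈ Icc (0 : ℝ) 1 :=
    ⟨by unfold orProb; nlinarith, by unfold orProb; nlinarith⟩
  have hX : v ∈ Icc (0 : ℝ) 1 := ⟨hv.le, by linarith⟩
  have hne : v ≠ orProb (2 * u) v := by unfold orProb; intro h; nlinarith
  have h1 := strictConcave_binEntropy.2 hX hY hne (sub_pos.2 hs1) hs0 (by ring)
  have h2 := strictConcave_binEntropy.2 hX hY hne hs0 (sub_pos.2 hs1) (by ring)
  have e1 : (1 - s) • v + s • orProb (2 * u) v = u := by
    simp only [smul_eq_mul, orProb]; linear_combination hs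
  have e2 : s • v + (1 - s) • orProb (2 * u) v = orProb (2 * v) u := by
    simp only [smul_eq_mul, orProb]; linear_combination -hs
  rw [e1] at h1
  rw [e2] at h2
  simp only [smul_eq_mul] at h1 h2
  have e3 : orProb u v = orProb v u := by unfold orProb; ring
  unfold splitGain
  rw [e3]
  linarith

end TopDownMIC

namespace TopDownMIC

/-! ### Trees and one step of TopDown -/

theorem mem_pairs {n : ℕ} (T : DTree n) (l : Path n) (i : Fin n) :
    (l, i) ∈ T.pairs ↔ l ∈ T.leaves ∧ i ∉ l.map Prod.fst := by
  simp only [DTree.pairs, List.mem_flatMap, List.mem_map, List.mem_filter, List.mem_finRange,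
    true_and, decide_eq_true_eq, Prod.mk.injEq]
  constructor
  · rintro ⟨m, hm, j, hj, rfl, rfl⟩
    exact ⟨hm, by simpa using hj⟩
  · rintro ⟨h1, h2⟩
    exact ⟨l, h1, i, by simpa using h2, rfl, rfl⟩

/-- The list `rest` does not depend on `S`, so the other leaves cancel when entropies before and
after a split are compared. -/
theorem leaves_replace {n : ℕ} (T : DTree n) (l : Path n) (hl : l ∈ T.leaves) :
    ∃ rest, T.leaves.Perm (l :: rest) ∧
      ∀ S : DTree n, (T.replace l S).leaves.Perm (S.leaves.map (l ++ ·) ++ rest) := by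
  induction T generalizing l with
  | leaf b =>
    obtain rfl : l = [] := by simpa [DTree.leaves] using hl
    exact ⟨[], by simp [DTree.leaves], fun S => by simp [DTree.replace]⟩
  | node i t₀ t₁ ih₀ ih₁ =>
    simp only [DTree.leaves, List.mem_append, List.mem_map] at hl
    rcases hl with ⟨m, hm, rfl⟩ | ⟨m, hm, rfl⟩
    · obtain ⟨rest, h1, h2⟩ := ih₀ m hm
      refine ⟨rest.map ((i, false) :: ·) ++ t₁.leaves.map ((i, true) :: ·), ?_, fun S => ?_⟩
      · have := (h1.map ((i, false) :: ·)).append_right (t₁.leaves.map ((i, true) :: ·))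
        simpa [DTree.leaves] using this
      · have := ((h2 S).map ((i, false) :: ·)).append_right (t₁.leaves.map ((i, true) :: ·))
        simpa [DTree.leaves, DTree.replace, Function.comp_def] using this
    · obtain ⟨rest, h1, h2⟩ := ih₁ m hm
      refine ⟨t₀.leaves.map ((i, false) :: ·) ++ rest.map ((i, true) :: ·), ?_, fun S => ?_⟩
      · have := (h1.map ((i, true) :: ·)).append_left (t₀.leaves.map ((i, false) :: ·))
        refine this.trans ?_
        simp only [List.map_cons]
        exact List.perm_middle
      · have := ((h2 S).map ((i, true) :: ·)).append_left (t₀.leaves.map ((i, false) :: ·))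
        simp only [DTree.leaves, DTree.replace]
        refine this.trans ?_
        simp only [List.map_append, List.map_map, ← List.append_assoc]
        refine List.Perm.append_right _ ?_
        exact List.perm_append_comm

theorem leaves_split {n : ℕ} (D : Dist n) (T : DTree n) (l : Path n) (hl : l ∈ T.leaves) :
    ∃ rest, T.leaves.Perm (l :: rest) ∧ ∀ i,
      (T.split D l i).leaves.Perm ((l ++ [(i, false)]) :: (l ++ [(i, true)]) :: rest) := by
  obtain ⟨rest, h1, h2⟩ := leaves_replace T l hl
  refine ⟨rest, h1, fun i => ?_⟩
  simpa [DTree.split, DTree.leaves] using h2 (.node i (.leaf (majority D (l ++ [(i, false)])))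
    (.leaf (majority D (l ++ [(i, true)]))))

/-- On no path of the tree is a variable tested twice. -/
def DTree.ReadsOnce {n : ℕ} (T : DTree n) : Prop :=
  ∀ l ∈ T.leaves, (l.map Prod.fst).Nodup

theorem DTree.ReadsOnce.split {n : ℕ} {T : DTree n} (hT : T.ReadsOnce) (D : Dist n) {l : Path n}
    (hl : l ∈ T.leaves) {i : Fin n} (hi : i ∉ l.map Prod.fst) : (T.split D l i).ReadsOnce := by
  obtain ⟨rest, h1, h2⟩ := leaves_split D T l hl
  intro m hm
  rw [(h2 i).mem_iff, List.mem_cons, List.mem_cons] at hm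
  rcases hm with rfl | rfl | hm
  · exact nodup_concat (hT l hl) _ hi
  · exact nodup_concat (hT l hl) _ hi
  · exact hT m (h1.mem_iff.2 (List.mem_cons_of_mem _ hm))

/-- The leaves below the node `p` are labelled by the function `lab` of the path. -/
def DTree.LabelledBy {n : ℕ} (lab : Path n → Bool) : Path n → DTree n → Prop
  | p, .leaf b => b = lab p
  | p, .node i t₀ t₁ =>
      DTree.LabelledBy lab (p ++ [(i, false)]) t₀ ∧ DTree.LabelledBy lab (p ++ [(i, true)]) t₁

theorem DTree.LabelledBy.replace {n : ℕ} {lab : Path n → Bool} {T : DTree n} {p : Path n}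
    (hT : DTree.LabelledBy lab p T) {l : Path n} (hl : l ∈ T.leaves) {S : DTree n}
    (hS : DTree.LabelledBy lab (p ++ l) S) : DTree.LabelledBy lab p (T.replace l S) := by
  induction T generalizing p l with
  | leaf b =>
    obtain rfl : l = [] := by simpa [DTree.leaves] using hl
    simpa [DTree.replace] using hS
  | node i t₀ t₁ ih₀ ih₁ =>
    simp only [DTree.leaves, List.mem_append, List.mem_map] at hl
    rcases hl with ⟨m, hm, rfl⟩ | ⟨m, hm, rfl⟩
    · exact ⟨ih₀ hT.1 hm (by simpa using hS), hT.2⟩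
    · exact ⟨hT.1, ih₁ hT.2 hm (by simpa using hS)⟩

theorem errAt_eq_sum {n : ℕ} (f : (Fin n → Bool) → Bool) {lab : Path n → Bool} {T : DTree n}
    {p : Path n} (hT : DTree.LabelledBy lab p T) :
    errAt f p T = (T.leaves.map fun l => errAt f (p ++ l) (.leaf (lab (p ++ l)))).sum := by
  induction T generalizing p with
  | leaf b =>
    simp only [DTree.LabelledBy] at hT
    simp [DTree.leaves, hT]
  | node i t₀ t₁ ih₀ ih₁ =>
    rw [errAt_node, ih₀ hT.1, ih₁ hT.2]
    simp [DTree.leaves, Function.comp_def]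

/-! ### The inner loop and the types of the leaves -/

theorem foldl_scan {n : ℕ} (D : Dist n) (T : DTree n) (L : List (Path n × Fin n))
    (best : ℝ × Option (Path n × Fin n)) :
    best.1 ≤ (L.foldl (scan D T) best).1 ∧
    (∀ c ∈ L, treeEntropy D T - treeEntropy D (T.split D c.1 c.2) ≤ (L.foldl (scan D T) best).1) ∧
    (L.foldl (scan D T) best = best ∨ ∃ c ∈ L, L.foldl (scan D T) best =
      (treeEntropy D T - treeEntropy D (T.split D c.1 c.2), some c)) := by
  induction L generalizing best with
  | nil => simp
  | cons a L ih =>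
    obtain ⟨h1, h2, h3⟩ := ih (scan D T best a)
    rw [List.foldl_cons]
    have ha : best.1 ≤ (scan D T best a).1 ∧
        treeEntropy D T - treeEntropy D (T.split D a.1 a.2) ≤ (scan D T best a).1 ∧
        (scan D T best a = best ∨ scan D T best a =
          (treeEntropy D T - treeEntropy D (T.split D a.1 a.2), some a)) := by
      unfold scan
      simp only
      split_ifs with h
      · exact ⟨h, le_rfl, Or.inr rfl⟩
      · exact ⟨le_rfl, (not_le.1 h).le, Or.inl rfl⟩
    refine ⟨ha.1.trans h1, ?_, ?_⟩
    · intro c hc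
      rcases List.mem_cons.1 hc with rfl | hc
      · exact ha.2.1.trans h1
      · exact h2 c hc
    · rcases h3 with h3 | ⟨c, hc, h3⟩
      · rcases ha.2.2 with h4 | h4
        · exact Or.inl (h3.trans h4)
        · exact Or.inr ⟨a, by simp, h3.trans h4⟩
      · exact Or.inr ⟨c, List.mem_cons_of_mem _ hc, h3⟩

/-- The entropy decrease of a split. -/
noncomputable def gain {n : ℕ} (D : Dist n) (T : DTree n) (l : Path n) (i : Fin n) : ℝ :=
  treeEntropy D T - treeEntropy D (T.split D l i)

/-- All that is used about the loop: the split performed is a maximal one. Of the order only the set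
of its pairs matters, hence the independence of tie-breaking. -/
theorem topDownStep_cases {n : ℕ} {order : DTree n → List (Path n × Fin n)}
    (horder : IsLoopOrder order) (D : Dist n) (T : DTree n) :
    (topDownStep order D T = T ∧ ∀ l ∈ T.leaves, ∀ i, i ∉ l.map Prod.fst → gain D T l i ≤ 0) ∨
    ∃ l ∈ T.leaves, ∃ i, i ∉ l.map Prod.fst ∧ topDownStep order D T = T.split D l i ∧
      ∀ m ∈ T.leaves, ∀ j, j ∉ m.map Prod.fst → gain D T m j ≤ gain D T l i := by
  obtain ⟨-, h2, h3⟩ := foldl_scan D T (order T) (0, none)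
  have key : ∀ m ∈ T.leaves, ∀ j, j ∉ m.map Prod.fst → (m, j) ∈ order T := fun m hm j hj =>
    (horder T).mem_iff.2 ((mem_pairs T m j).2 ⟨hm, hj⟩)
  rcases h3 with h3 | ⟨c, hc, h3⟩
  · left
    refine ⟨by simp [topDownStep, h3], fun m hm j hj => ?_⟩
    have := h2 _ (key m hm j hj)
    rwa [h3] at this
  · right
    have hc' := (mem_pairs T c.1 c.2).1 ((horder T).mem_iff.1 hc)
    refine ⟨c.1, hc'.1, c.2, hc'.2, by simp [topDownStep, h3], fun m hm j hj => ?_⟩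
    have := h2 _ (key m hm j hj)
    rwa [h3] at this

theorem topDown_readsOnce_labelledBy {n : ℕ} {order : DTree n → List (Path n × Fin n)}
    (horder : IsLoopOrder order) (D : Dist n) (t : ℕ) :
    (topDown order D t).ReadsOnce ∧ DTree.LabelledBy (majority D) [] (topDown order D t) := by
  induction t with
  | zero => simp [topDown, DTree.ReadsOnce, DTree.leaves, DTree.LabelledBy]
  | succ t ih =>
    rw [topDown]
    rcases topDownStep_cases horder D (topDown order D t) with ⟨h, -⟩ | ⟨l, hl, i, hi, h, -⟩
    · rwa [h]
    · rw [h]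
      exact ⟨ih.1.split D hl hi, ih.2.replace hl (by simp [DTree.LabelledBy])⟩

theorem testError_uniformDist {n : ℕ} (f : (Fin n → Bool) → Bool) (T : DTree n) :
    testError (uniformDist f) T = errAt f [] T := by
  unfold testError errAt
  rw [prob_uniformDist]
  refine pr_congr fun x => ?_
  simp [Term.Holds]

/-- The depth of a node and the numbers of undecided literals of the two terms. -/
abbrev NodeType := ℕ × Option ℕ × Option ℕ

/-- The type of the node at the end of a path. -/
def nodeType {n : ℕ} (c d : Term n) (l : Path n) : NodeType := (l.length, rem c l, rem d l)

/-- The types of the leaves of a tree. -/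
def leafTypes {n : ℕ} (c d : Term n) (T : DTree n) : List NodeType := T.leaves.map (nodeType c d)

/-- The contribution of a leaf to the entropy of the tree. -/
noncomputable def NodeType.contrib (x : NodeType) : ℝ :=
  (1 / 2) ^ x.1 * entropy (orProb (val x.2.1) (val x.2.2))

/-- A bound for the contribution of a leaf to the error of the tree. -/
noncomputable def NodeType.err (x : NodeType) : ℝ :=
  (1 / 2) ^ x.1 * min (orProb (val x.2.1) (val x.2.2)) (1 - orProb (val x.2.1) (val x.2.2))

/-- The types of the two children of a node. -/
def NodeType.Splits : NodeType → NodeType → NodeType → Prop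
  | (k, r, s), X, Y =>
    (r ≠ some 0 ∧ X = (k + 1, down r, s) ∧ Y = (k + 1, none, s)) ∨
    (s ≠ some 0 ∧ X = (k + 1, r, down s) ∧ Y = (k + 1, r, none)) ∨
    (X = (k + 1, r, s) ∧ Y = (k + 1, r, s))

/-- The entropy decrease of a split of a node. -/
noncomputable def NodeType.gain (x X Y : NodeType) : ℝ := x.contrib - X.contrib - Y.contrib

/-- The function is constant at the node. -/
def NodeType.Pure (x : NodeType) : Prop :=
  x.2.1 = some 0 ∨ x.2.2 = some 0 ∨ (x.2.1 = none ∧ x.2.2 = none)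

section

variable {n : ℕ} {f : (Fin n → Bool) → Bool} {c d : Term n}

theorem TwoTerm.reachProb (l : Path n) (hl : (l.map Prod.fst).Nodup) :
    reachProb (uniformDist f) l = (1 / 2) ^ l.length := by
  rw [TopDownMIC.reachProb, prob_uniformDist, ← pr_holds l hl]
  rfl

theorem TwoTerm.condProb (h : TwoTerm f c d) (l : Path n) (hl : (l.map Prod.fst).Nodup) :
    condProb (uniformDist f) l = orProb (val (rem c l)) (val (rem d l)) := by
  rw [TopDownMIC.condProb, TwoTerm.reachProb l hl, prob_uniformDist]
  have := h.pr_true l hl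
  simp only [Set.mem_ofPred_eq]
  rw [this]
  field_simp

theorem TwoTerm.contrib (h : TwoTerm f c d) (l : Path n) (hl : (l.map Prod.fst).Nodup) :
    TopDownMIC.reachProb (uniformDist f) l * entropy (TopDownMIC.condProb (uniformDist f) l) =
      (nodeType c d l).contrib := by
  rw [TwoTerm.reachProb l hl, h.condProb l hl]
  rfl

theorem TwoTerm.errAt_majority_le (h : TwoTerm f c d) (l : Path n) (hl : (l.map Prod.fst).Nodup) :
    errAt f l (.leaf (majority (uniformDist f) l)) ≤ (nodeType c d l).err := by
  unfold majority
  rw [h.condProb l hl]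
  simp only [NodeType.err, nodeType]
  by_cases hq : 1 / 2 ≤ orProb (val (rem c l)) (val (rem d l))
  · rw [decide_eq_true hq, errAt_leaf_true h l hl, min_eq_right (by linarith)]
  · rw [decide_eq_false hq, errAt_leaf_false h l hl, min_eq_left (by linarith)]

theorem TwoTerm.testError_le (h : TwoTerm f c d) {T : DTree n} (hT : T.ReadsOnce)
    (hT' : DTree.LabelledBy (majority (uniformDist f)) [] T) :
    testError (uniformDist f) T ≤ ((leafTypes c d T).map NodeType.err).sum := by
  rw [testError_uniformDist, errAt_eq_sum f hT', leafTypes, List.map_map]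
  refine List.sum_le_sum fun l hl => ?_
  exact h.errAt_majority_le l (hT l hl)

theorem TwoTerm.splits (h : TwoTerm f c d) (l : Path n) (i : Fin n)
    (hi : i ∉ l.map Prod.fst) : ∃ X Y, (nodeType c d l).Splits X Y ∧
      List.Perm [nodeType c d (l ++ [(i, false)]), nodeType c d (l ++ [(i, true)])] [X, Y] ∧
      (i ∈ c.map Prod.fst →
        X = (l.length + 1, down (rem c l), rem d l) ∧ Y = (l.length + 1, none, rem d l)) ∧
      (i ∈ d.map Prod.fst →
        X = (l.length + 1, rem c l, down (rem d l)) ∧ Y = (l.length + 1, rem c l, none)) := by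
  simp only [nodeType, NodeType.Splits, List.length_append, List.length_singleton]
  have key1 := rem_concat_cases c h.nodup_left l i hi
  have key2 := rem_concat_cases d h.symm.nodup_left l i hi
  rcases key1 with ⟨hc, e1⟩ | ⟨hc, hr, s, e1, e1'⟩
  · rcases key2 with ⟨hd, e2⟩ | ⟨hd, hr, s, e2, e2'⟩
    · exact ⟨_, _, Or.inr (Or.inr ⟨rfl, rfl⟩), by rw [e1, e1, e2, e2],
        fun h => (hc h).elim, fun h => (hd h).elim⟩
    · refine ⟨_, _, Or.inr (Or.inl ⟨hr, rfl, rfl⟩), ?_, fun h => (hc h).elim, fun _ => ⟨rfl, rfl⟩⟩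
      cases s
      · simp only [Bool.not_false] at e2'
        rw [e1, e1, e2, e2']
      · simp only [Bool.not_true] at e2'
        rw [e1, e1, e2, e2']
        exact List.Perm.swap _ _ _
  · rcases key2 with ⟨hd, e2⟩ | ⟨hd, -⟩
    · refine ⟨_, _, Or.inl ⟨hr, rfl, rfl⟩, ?_, fun _ => ⟨rfl, rfl⟩, fun h => (hd h).elim⟩
      cases s
      · simp only [Bool.not_false] at e1'
        rw [e1, e1', e2, e2]
      · simp only [Bool.not_true] at e1'
        rw [e1, e1', e2, e2]
        exact List.Perm.swap _ _ _
    · exact (h.disjoint hc hd).elim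

theorem TwoTerm.leafTypes_split (h : TwoTerm f c d) {T : DTree n} (hT : T.ReadsOnce) {l : Path n}
    (hl : l ∈ T.leaves) {i : Fin n} (hi : i ∉ l.map Prod.fst) :
    ∃ X Y others, (nodeType c d l).Splits X Y ∧
      (leafTypes c d T).Perm (nodeType c d l :: others) ∧
      (leafTypes c d (T.split (uniformDist f) l i)).Perm (X :: Y :: others) ∧
      gain (uniformDist f) T l i = (nodeType c d l).gain X Y ∧
      (i ∈ c.map Prod.fst →
        X = (l.length + 1, down (rem c l), rem d l) ∧ Y = (l.length + 1, none, rem d l)) ∧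
      (i ∈ d.map Prod.fst →
        X = (l.length + 1, rem c l, down (rem d l)) ∧ Y = (l.length + 1, rem c l, none)) := by
  obtain ⟨rest, h1, h2⟩ := leaves_split (uniformDist f) T l hl
  obtain ⟨X, Y, hs, hp, hXc, hXd⟩ := h.splits l i hi
  refine ⟨X, Y, rest.map (nodeType c d), hs, h1.map _, ?_, ?_, hXc, hXd⟩
  · exact ((h2 i).map (nodeType c d)).trans (hp.append_right (rest.map (nodeType c d)))
  · have e1 := (h1.map fun l => TopDownMIC.reachProb (uniformDist f) l *
      entropy (TopDownMIC.condProb (uniformDist f) l)).sum_eq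
    have e2 := ((h2 i).map fun l => TopDownMIC.reachProb (uniformDist f) l *
      entropy (TopDownMIC.condProb (uniformDist f) l)).sum_eq
    have e3 := (hp.map NodeType.contrib).sum_eq
    simp only [List.map_cons, List.sum_cons, List.map_nil, List.sum_nil, add_zero] at e1 e2 e3
    rw [h.contrib l (hT l hl)] at e1
    rw [h.contrib _ (nodup_concat (hT l hl) false hi),
      h.contrib _ (nodup_concat (hT l hl) true hi)] at e2
    unfold gain NodeType.gain treeEntropy
    linarith

end

/-! ### Entropy gains and purity of node types -/

theorem val_down {r : Option ℕ} (hr : r ≠ some 0) : val (down r) = 2 * val r := by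
  cases r with
  | none => simp [down, val]
  | some k =>
    obtain ⟨k, rfl⟩ : ∃ j, k = j + 1 := Nat.exists_eq_succ_of_ne_zero fun h : k = 0 => hr (by rw [h])
    simp only [down, val, Nat.add_sub_cancel, pow_succ]
    ring

theorem orProb_comm (u v : ℝ) : orProb u v = orProb v u := by unfold orProb; ring

theorem gain_left (k : ℕ) {r : Option ℕ} (s : Option ℕ) (hr : r ≠ some 0) :
    NodeType.gain (k, r, s) (k + 1, down r, s) (k + 1, none, s) =
      (1 / 2) ^ k / Real.log 2 * splitGain (val r) (val s) := by
  have : orProb 0 (val s) = val s := by simp [orProb]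
  simp only [NodeType.gain, NodeType.contrib, val_down hr, entropy_eq, splitGain, pow_succ]
  rw [show val none = 0 from rfl, this]
  ring

theorem gain_right (k : ℕ) (r : Option ℕ) {s : Option ℕ} (hs : s ≠ some 0) :
    NodeType.gain (k, r, s) (k + 1, r, down s) (k + 1, r, none) =
      (1 / 2) ^ k / Real.log 2 * splitGain (val s) (val r) := by
  rw [← gain_left k r hs]
  simp only [NodeType.gain, NodeType.contrib, orProb_comm]

theorem gain_irrelevant (k : ℕ) (r s : Option ℕ) :
    NodeType.gain (k, r, s) (k + 1, r, s) (k + 1, r, s) = 0 := by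
  simp only [NodeType.gain, NodeType.contrib, pow_succ]
  ring

theorem splitGain_zero_left (v : ℝ) : splitGain 0 v = 0 := by
  simp only [splitGain, orProb]
  ring_nf

theorem contrib_nonneg (x : NodeType) : 0 ≤ x.contrib := by
  unfold NodeType.contrib
  rw [entropy_eq]
  have h1 := val_nonneg x.2.1
  have h2 := val_nonneg x.2.2
  have h3 := val_le_one x.2.1
  have h4 := val_le_one x.2.2
  have := Real.binEntropy_nonneg (p := orProb (val x.2.1) (val x.2.2))
    (by unfold orProb; nlinarith) (by unfold orProb; nlinarith)
  have := Real.log_pos one_lt_two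
  positivity

theorem NodeType.Pure.orProb {x : NodeType} (hx : x.Pure) :
    orProb (val x.2.1) (val x.2.2) = 1 ∨ orProb (val x.2.1) (val x.2.2) = 0 := by
  rcases hx with h | h | ⟨h, h'⟩
  · left; rw [h]; simp [TopDownMIC.orProb, val]
  · left; rw [h]; simp [TopDownMIC.orProb, val]
  · right; rw [h, h']; simp [TopDownMIC.orProb, val]

theorem NodeType.Pure.gain_nonpos {x : NodeType} (hx : x.Pure) (X Y : NodeType) :
    x.gain X Y ≤ 0 := by
  have h1 := contrib_nonneg X
  have h2 := contrib_nonneg Y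
  have h3 : x.contrib = 0 := by
    unfold NodeType.contrib
    rw [entropy_eq]
    rcases hx.orProb with h | h <;> simp [h]
  unfold NodeType.gain
  linarith

theorem NodeType.Pure.err_eq_zero {x : NodeType} (hx : x.Pure) : x.err = 0 := by
  unfold NodeType.err
  rcases hx.orProb with h | h <;> simp [h]

theorem NodeType.Pure.splits {x X Y : NodeType} (hx : x.Pure) (h : x.Splits X Y) :
    X.Pure ∧ Y.Pure := by
  obtain ⟨k, r, s⟩ := x
  simp only [NodeType.Pure, NodeType.Splits] at *
  rcases h with ⟨h, rfl, rfl⟩ | ⟨h, rfl, rfl⟩ | ⟨rfl, rfl⟩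
  · rcases hx with hx | hx | ⟨rfl, rfl⟩
    · exact (h hx).elim
    · simp [hx]
    · simp [down]
  · rcases hx with hx | hx | ⟨rfl, rfl⟩
    · simp [hx]
    · exact (h hx).elim
    · simp [down]
  · exact ⟨hx, hx⟩

end TopDownMIC

namespace TopDownMIC

/-! ### The stages of TopDown -/

/-- The type of a finished branch: the first term is false and no variable of the second one has
been tested. -/
def branch (b j : ℕ) : NodeType := (j, none, some b)

section

variable {n : ℕ} {f : (Fin n → Bool) → Bool} {c d : Term n}
  {order : DTree n → List (Path n × Fin n)}

theorem TwoTerm.exists_gain_eq (h : TwoTerm f c d) {T : DTree n} (hT : T.ReadsOnce)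
    {x X Y : NodeType} (hx : x ∈ leafTypes c d T)
    (hX : (∃ k j s, x = (k, some (j + 1), s) ∧ X = (k + 1, some j, s) ∧ Y = (k + 1, none, s)) ∨
      ∃ k r j, x = (k, r, some (j + 1)) ∧ X = (k + 1, r, some j) ∧ Y = (k + 1, r, none)) :
    ∃ l ∈ T.leaves, ∃ i, i ∉ l.map Prod.fst ∧ gain (uniformDist f) T l i = x.gain X Y := by
  obtain ⟨l, hl, rfl⟩ := List.mem_map.1 hx
  refine ⟨l, hl, ?_⟩
  rcases hX with ⟨k, j, s, e, rfl, rfl⟩ | ⟨k, r, j, e, rfl, rfl⟩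
  · have e1 : rem c l = some (j + 1) := congrArg (fun x : NodeType => x.2.1) e
    obtain ⟨i, hi, hil⟩ := exists_of_rem_succ c l j e1
    obtain ⟨X, Y, -, -, -, -, hg, hXc, -⟩ := h.leafTypes_split hT hl hil
    refine ⟨i, hil, ?_⟩
    obtain ⟨rfl, rfl⟩ := hXc hi
    rw [hg]
    simp only [nodeType, Prod.mk.injEq] at e
    rw [e.1, e.2.2, e1]
    rfl
  · have e1 : rem d l = some (j + 1) := congrArg (fun x : NodeType => x.2.2) e
    obtain ⟨i, hi, hil⟩ := exists_of_rem_succ d l j e1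
    obtain ⟨X, Y, -, -, -, -, hg, -, hXd⟩ := h.leafTypes_split hT hl hil
    refine ⟨i, hil, ?_⟩
    obtain ⟨rfl, rfl⟩ := hXd hi
    rw [hg]
    simp only [nodeType, Prod.mk.injEq] at e
    rw [e.1, e.2.1, e1]
    rfl

/-- If a split of a leaf beats all splits of leaves of other types, then TopDown splits a leaf of
that type. -/
theorem TwoTerm.step_of_dominant (h : TwoTerm f c d) (horder : IsLoopOrder order) {T : DTree n}
    (hT : T.ReadsOnce) {x X₀ Y₀ : NodeType} {others : List NodeType}
    (hp : (leafTypes c d T).Perm (x :: others))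
    (hX : (∃ k j s, x = (k, some (j + 1), s) ∧ X₀ = (k + 1, some j, s) ∧ Y₀ = (k + 1, none, s)) ∨
      ∃ k r j, x = (k, r, some (j + 1)) ∧ X₀ = (k + 1, r, some j) ∧ Y₀ = (k + 1, r, none))
    (hpos : 0 < x.gain X₀ Y₀)
    (hdom : ∀ y ∈ others, ∀ X Y, y.Splits X Y → y.gain X Y < x.gain X₀ Y₀) :
    ∃ X Y, x.Splits X Y ∧ x.gain X₀ Y₀ ≤ x.gain X Y ∧
      (leafTypes c d (topDownStep order (uniformDist f) T)).Perm (X :: Y :: others) := by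
  obtain ⟨l₀, hl₀, i₀, hi₀, hg₀⟩ := h.exists_gain_eq hT (hp.mem_iff.2 (by simp)) hX
  rcases topDownStep_cases horder (uniformDist f) T with ⟨-, hle⟩ | ⟨l, hl, i, hi, hs, hle⟩
  · have := hle l₀ hl₀ i₀ hi₀
    linarith
  · obtain ⟨X, Y, rest, hsp, h1, h2, hg, -⟩ := h.leafTypes_split hT hl hi
    have hle₀ := hle l₀ hl₀ i₀ hi₀
    rw [hg, hg₀] at hle₀
    have hy : nodeType c d l ∈ x :: others := hp.mem_iff.1 (List.mem_map_of_mem hl)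
    rcases List.mem_cons.1 hy with hy | hy
    · rw [hy] at h1 hsp hle₀
      refine ⟨X, Y, hsp, hle₀, ?_⟩
      rw [hs]
      refine h2.trans (((List.Perm.cons_inv (h1.symm.trans hp)).cons Y).cons X)
    · have := hdom _ hy X Y hsp
      linarith

end

theorem gain_scale_pos (k : ℕ) : 0 < (1 / 2 : ℝ) ^ k / Real.log 2 := by
  have := Real.log_pos one_lt_two
  positivity

theorem splitGain_half_pow_pos (b : ℕ) (hb : 1 ≤ b) : 0 < splitGain ((1 / 2) ^ b) 0 := by
  refine splitGain_pos (by positivity) ?_ le_rfl one_pos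
  simpa using pow_le_pow_of_le_one (by norm_num) (by norm_num : (1 / 2 : ℝ) ≤ 1) hb

/-- Only a test of the living term gains anything, and its gain is weighted by the probability of
the branch, which decreases with depth. -/
theorem gain_branch_le {b : ℕ} (hb : 1 ≤ b) {j i : ℕ} (hij : i ≤ j) {X Y : NodeType}
    (h : (branch b j).Splits X Y) :
    (branch b j).gain X Y ≤ (1 / 2) ^ i / Real.log 2 * splitGain ((1 / 2) ^ b) 0 := by
  have h0 := splitGain_half_pow_pos b hb
  have h1 := mul_pos (gain_scale_pos i) h0
  unfold branch at *
  rcases h with ⟨h, rfl, rfl⟩ | ⟨h, rfl, rfl⟩ | ⟨rfl, rfl⟩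
  · rw [gain_left _ _ h, show val none = 0 from rfl, splitGain_zero_left, mul_zero]
    exact h1.le
  · rw [gain_right _ _ h]
    refine mul_le_mul_of_nonneg_right ?_ h0.le
    have := Real.log_pos one_lt_two
    have := pow_le_pow_of_le_one (by norm_num) (by norm_num : (1 / 2 : ℝ) ≤ 1) hij
    gcongr
  · rw [gain_irrelevant]
    exact h1.le

/-- The leaves while the first term is being tested. -/
def spine (a b t : ℕ) : List NodeType :=
  (t, some (a - t), some b) :: (List.range t).map fun j => branch b (j + 1)

/-- The leaves that are left when the second term is being tested in the branch number `m + 1`, and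
`r` of its variables have been tested there. -/
def unfinished (a b m r : ℕ) : List NodeType :=
  (m + 1 + r, none, some (b - r)) :: (List.range (a - 1 - m)).map fun j => branch b (m + 2 + j)

/-- The types of the leaves of the tree that TopDown returns after `t` iterations. -/
def Stage {n : ℕ} (c d : Term n) (a b t : ℕ) (T : DTree n) : Prop :=
  (t < a ∧ (leafTypes c d T).Perm (spine a b t)) ∨
  (∃ m r, t = a + b * m + r ∧ m < a ∧ r < b ∧ ∃ done, (∀ x ∈ done, NodeType.Pure x) ∧
    (leafTypes c d T).Perm (unfinished a b m r ++ done)) ∨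
  (a + b * a ≤ t ∧ ∀ x ∈ leafTypes c d T, NodeType.Pure x)

section

variable {n : ℕ} {f : (Fin n → Bool) → Bool} {c d : Term n}
  {order : DTree n → List (Path n × Fin n)}

theorem half_pow_le_half {k : ℕ} (hk : 1 ≤ k) : (1 / 2 : ℝ) ^ k ≤ 1 / 2 := by
  simpa using pow_le_pow_of_le_one (by norm_num) (by norm_num : (1 / 2 : ℝ) ≤ 1) hk

/-- The heaviest competitor is the branch at depth `1`. Since `a ≤ b`, the weight `(1 / 2) ^ t` is
at least `v / u`, with equality for `a = b`; this removes `t` and leaves an inequality in `u` and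
`v`. -/
theorem splitGain_spine {a b t : ℕ} (hab : a ≤ b) (ht : 1 ≤ t) (hta : t < a) :
    1 / 2 * splitGain ((1 / 2) ^ b) 0 <
      (1 / 2) ^ t * splitGain ((1 / 2) ^ (a - t)) ((1 / 2) ^ b) := by
  have hb : 2 ≤ b := by omega
  have hu0 : 0 < (1 / 2 : ℝ) ^ (a - t) := by positivity
  have hu1 := half_pow_le_half (show 1 ≤ a - t by omega)
  have hv0 : 0 < (1 / 2 : ℝ) ^ b := by positivity
  have key : splitGain ((1 / 2) ^ b) 0 / 2 <
      (1 / 2) ^ b / (1 / 2) ^ (a - t) * splitGain ((1 / 2) ^ (a - t)) ((1 / 2) ^ b) := by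
    rcases hb.eq_or_lt with rfl | hb
    · obtain rfl : a = 2 := by omega
      obtain rfl : t = 1 := by omega
      have := splitGain_quarter
      norm_num at this ⊢
      exact this
    · refine splitGain_zero_right_lt_of_le_eighth hv0 ?_ ?_ hu1
      · have := pow_le_pow_of_le_one (by norm_num) (by norm_num : (1 / 2 : ℝ) ≤ 1) hb
        norm_num at this ⊢
        exact this
      · have := pow_le_pow_of_le_one (by norm_num) (by norm_num : (1 / 2 : ℝ) ≤ 1)
          (show a - t + 1 ≤ b by omega)
        rw [pow_succ] at this
        linarith
  have hpos : 0 < splitGain ((1 / 2) ^ (a - t)) ((1 / 2) ^ b) :=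
    splitGain_pos hu0 hu1 hv0.le
      ((half_pow_le_half (show 1 ≤ b by omega)).trans_lt (by norm_num))
  have h1 : (1 / 2 : ℝ) ^ b / (1 / 2) ^ (a - t) ≤ (1 / 2) ^ t := by
    rw [div_le_iff₀ hu0, ← pow_add]
    exact pow_le_pow_of_le_one (by norm_num) (by norm_num) (by omega)
  have := mul_le_mul_of_nonneg_right h1 hpos.le
  linarith

/-- The quantity `(1 / 2) ^ b * log 2` separates the sides: it is strictly below the right one and
at least the left one. -/
theorem splitGain_unfinished {b r : ℕ} (hr : r < b) :
    1 / 2 * splitGain ((1 / 2) ^ b) 0 < (1 / 2) ^ r * splitGain ((1 / 2) ^ (b - r)) 0 := by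
  have h1 := mul_log_two_lt_splitGain (v := (1 / 2) ^ (b - r)) (by positivity)
    (half_pow_le_half (by omega))
  have h2 : splitGain ((1 / 2) ^ b) 0 ≤ 2 * ((1 / 2) ^ b * Real.log 2) := by
    refine splitGain_zero_right_le (by positivity) ?_
    rcases (show 1 ≤ b by omega).eq_or_lt with rfl | hb
    · right; norm_num
    · left
      have := pow_le_pow_of_le_one (by norm_num) (by norm_num : (1 / 2 : ℝ) ≤ 1) hb
      norm_num at this ⊢
      exact this
  have h3 : (1 / 2 : ℝ) ^ b = (1 / 2) ^ r * (1 / 2) ^ (b - r) := by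
    rw [← pow_add]; congr 1; omega
  have h4 := mul_lt_mul_of_pos_left h1 (show 0 < (1 / 2 : ℝ) ^ r by positivity)
  rw [h3] at h2 ⊢
  linarith

theorem range_map_branch (b t : ℕ) :
    List.Perm (branch b (t + 1) :: (List.range t).map fun j => branch b (j + 1))
      ((List.range (t + 1)).map fun j => branch b (j + 1)) := by
  rw [List.range_succ, List.map_append]
  exact (List.perm_append_singleton _ _).symm

theorem stage_succ_of_spine {a b t : ℕ} (hb : 1 ≤ b) (hta : t < a) {T : DTree n}
    (hp : (leafTypes c d T).Perm ((t + 1, some (a - t - 1), some b) :: (t + 1, none, some b) ::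
      (List.range t).map fun j => branch b (j + 1))) : Stage c d a b (t + 1) T := by
  have hp' := hp.trans ((range_map_branch b t).cons _)
  by_cases h : t + 1 < a
  · left
    refine ⟨h, ?_⟩
    rwa [spine, Nat.sub_add_eq]
  · right; left
    -- The spine is complete: its last leaf satisfies the first term and is pure, and the branch at
    -- depth `1` becomes the current one.
    obtain rfl : a = t + 1 := by omega
    refine ⟨0, 0, by simp, by omega, by omega, [(t + 1, some (t + 1 - t - 1), some b)], ?_, ?_⟩
    · simp [NodeType.Pure]
    · refine hp'.trans ((List.perm_append_singleton _ _).symm.trans ?_)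
      refine List.Perm.append_right _ ?_
      rw [List.range_succ_eq_map, unfinished]
      simp [branch, Function.comp_def, add_comm, add_left_comm]

theorem gain_spine_pos {a b t : ℕ} (hb : 1 ≤ b) (hta : t < a) :
    0 < splitGain ((1 / 2) ^ (a - t)) ((1 / 2) ^ b) :=
  splitGain_pos (by positivity) (half_pow_le_half (by omega)) (by positivity)
    ((half_pow_le_half hb).trans_lt (by norm_num))

/-- The second alternative is the one tie between the terms: at the root, with equal lengths, the
loop may choose the second term. -/
theorem TwoTerm.step_spine (h : TwoTerm f c d) (horder : IsLoopOrder order) {T : DTree n}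
    (hT : T.ReadsOnce) {a b t : ℕ} (hab : a ≤ b) (hta : t < a)
    (hp : (leafTypes c d T).Perm (spine a b t)) :
    Stage c d a b (t + 1) (topDownStep order (uniformDist f) T) ∨
    t = 0 ∧ a = b ∧ (leafTypes c d (topDownStep order (uniformDist f) T)).Perm
      [(1, some a, some (b - 1)), (1, some a, none)] := by
  have hb : 1 ≤ b := by omega
  have e : ∃ k, a - t = k + 1 := ⟨a - t - 1, by omega⟩
  have hne : some (a - t) ≠ some 0 := by simp; omega
  have hpos := gain_spine_pos hb hta
  have hgain := gain_left t (r := some (a - t)) (some b) hne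
  simp only [val, down] at hgain
  obtain ⟨X, Y, hs, hle, hp'⟩ := h.step_of_dominant horder hT hp
    (X₀ := (t + 1, some (a - t - 1), some b)) (Y₀ := (t + 1, none, some b))
    (by
      left
      obtain ⟨k, hk⟩ := e
      refine ⟨t, k, some b, by rw [hk], by rw [hk, Nat.add_sub_cancel], rfl⟩)
    (by rw [hgain]; exact mul_pos (gain_scale_pos t) hpos)
    (by
      intro y hy X Y hXY
      obtain ⟨j, hj, rfl⟩ := List.mem_map.1 hy
      rw [List.mem_range] at hj
      refine (gain_branch_le hb (show 1 ≤ j + 1 by omega) hXY).trans_lt ?_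
      rw [hgain, div_mul_eq_mul_div, div_mul_eq_mul_div, pow_one]
      exact div_lt_div_of_pos_right (splitGain_spine hab (by omega) hta)
        (Real.log_pos one_lt_two))
  rw [hgain] at hle
  rcases hs with ⟨-, rfl, rfl⟩ | ⟨h2, rfl, rfl⟩ | ⟨rfl, rfl⟩
  · exact Or.inl (stage_succ_of_spine hb hta hp')
  · rw [gain_right _ _ h2] at hle
    have hle' := le_of_mul_le_mul_left hle (gain_scale_pos t)
    simp only [val] at hle'
    rcases (show a - t ≤ b by omega).eq_or_lt with h3 | h3
    · obtain rfl : t = 0 := by omega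
      obtain rfl : a = b := by omega
      exact Or.inr ⟨rfl, rfl, by simpa [down] using hp'⟩
    · have := splitGain_lt_splitGain (u := (1 / 2) ^ (a - t)) (v := (1 / 2) ^ b) (by positivity)
        (pow_lt_pow_right_of_lt_one₀ (by norm_num) (by norm_num) h3) (half_pow_le_half (by omega))
      linarith
  · rw [gain_irrelevant] at hle
    have := mul_pos (gain_scale_pos t) hpos
    linarith

theorem TwoTerm.step_unfinished (h : TwoTerm f c d) (horder : IsLoopOrder order) {T : DTree n}
    (hT : T.ReadsOnce) {a b m r : ℕ} (hr : r < b) {done : List NodeType}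
    (hdone : ∀ x ∈ done, NodeType.Pure x)
    (hp : (leafTypes c d T).Perm (unfinished a b m r ++ done)) :
    (leafTypes c d (topDownStep order (uniformDist f) T)).Perm
      ((m + 1 + r + 1, none, some (b - r - 1)) :: (m + 1 + r + 1, none, none) ::
        ((List.range (a - 1 - m)).map (fun j => branch b (m + 2 + j)) ++ done)) := by
  have hne : some (b - r) ≠ some 0 := by simp; omega
  have hpos := splitGain_half_pow_pos (b - r) (by omega)
  have hgain := gain_right (m + 1 + r) none hne
  simp only [val, down] at hgain
  have hgain0 : 0 < (1 / 2) ^ (m + 1 + r) / Real.log 2 * splitGain ((1 / 2) ^ (b - r)) 0 :=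
    mul_pos (gain_scale_pos _) hpos
  obtain ⟨X, Y, hs, hle, hp'⟩ := h.step_of_dominant horder hT hp
    (X₀ := (m + 1 + r + 1, none, some (b - r - 1))) (Y₀ := (m + 1 + r + 1, none, none))
    (by
      right
      obtain ⟨k, hk⟩ : ∃ k, b - r = k + 1 := ⟨b - r - 1, by omega⟩
      exact ⟨_, none, k, by rw [hk], by rw [hk, Nat.add_sub_cancel], rfl⟩)
    (by rw [hgain]; exact hgain0)
    (by
      intro y hy X Y hXY
      rw [hgain]
      rcases List.mem_append.1 hy with hy | hy
      · obtain ⟨j, hj, rfl⟩ := List.mem_map.1 hy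
        refine (gain_branch_le (show 1 ≤ b by omega) (show m + 2 ≤ m + 2 + j by omega)
          hXY).trans_lt ?_
        have := mul_lt_mul_of_pos_left (splitGain_unfinished hr) (gain_scale_pos (m + 1))
        refine (lt_of_eq_of_lt ?_ this).trans_eq ?_ <;> ring
      · exact ((hdone y hy).gain_nonpos X Y).trans_lt hgain0)
  rw [hgain] at hle
  rcases hs with ⟨h2, rfl, rfl⟩ | ⟨-, rfl, rfl⟩ | ⟨rfl, rfl⟩
  · rw [gain_left _ _ h2, show val none = 0 from rfl, splitGain_zero_left] at hle
    linarith
  · exact hp'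
  · rw [gain_irrelevant] at hle
    linarith

theorem stage_succ_of_unfinished {a b m r : ℕ} (hm : m < a) (hr : r < b) {T : DTree n}
    {done : List NodeType} (hdone : ∀ x ∈ done, NodeType.Pure x)
    (hp : (leafTypes c d T).Perm
      ((m + 1 + r + 1, none, some (b - r - 1)) :: (m + 1 + r + 1, none, none) ::
        ((List.range (a - 1 - m)).map (fun j => branch b (m + 2 + j)) ++ done))) :
    Stage c d a b (a + b * m + r + 1) T := by
  have hpure : NodeType.Pure (m + 1 + r + 1, none, none) := by simp [NodeType.Pure]
  by_cases h : r + 1 < b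
  · right; left
    refine ⟨m, r + 1, by ring, hm, h, (m + 1 + r + 1, none, none) :: done, ?_, ?_⟩
    · simpa [hpure] using hdone
    · refine hp.trans ?_
      rw [unfinished, List.cons_append, Nat.sub_add_eq]
      exact List.Perm.cons _ List.perm_middle.symm
  · obtain rfl : b = r + 1 := by omega
    have hpure' : NodeType.Pure (m + 1 + r + 1, none, some (r + 1 - r - 1)) := by
      simp [NodeType.Pure]
    right
    by_cases h : m + 1 < a
    · left
      refine ⟨m + 1, 0, by ring, h, by omega, (m + 1 + r + 1, none, some (r + 1 - r - 1)) ::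
        (m + 1 + r + 1, none, none) :: done, ?_, ?_⟩
      · exact List.forall_mem_cons.2 ⟨hpure', List.forall_mem_cons.2 ⟨hpure, hdone⟩⟩
      · refine hp.trans ?_
        have e : a - 1 - m = a - 1 - (m + 1) + 1 := by omega
        rw [e, List.range_succ_eq_map, unfinished]
        simp only [List.map_cons, List.map_map, Function.comp_def]
        have e2 : (fun j => branch (r + 1) (m + 2 + (j.succ))) =
            fun j => branch (r + 1) (m + 1 + 2 + j) := by
          funext j; congr 1; simp only [Nat.succ_eq_add_one]; ring
        rw [e2]
        refine ((List.perm_middle (l₁ := [_, _])).trans ?_)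
        refine List.Perm.cons _ ?_
        refine (List.perm_append_comm_assoc [_, _] _ done).trans ?_
        exact List.Perm.refl _
    · right
      obtain rfl : a = m + 1 := by omega
      refine ⟨by ring_nf; omega, fun x hx => ?_⟩
      rw [hp.mem_iff] at hx
      simp only [show m + 1 - 1 - m = 0 by omega, List.range_zero, List.map_nil, List.nil_append,
        List.mem_cons] at hx
      rcases hx with rfl | rfl | hx
      · exact hpure'
      · exact hpure
      · exact hdone x hx

/-- The loop accepts splits of gain `0`, so the tree may keep growing after all leaves are pure;
this does no harm. -/
theorem TwoTerm.step_pure (h : TwoTerm f c d) (horder : IsLoopOrder order) {T : DTree n}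
    (hT : T.ReadsOnce) (hp : ∀ x ∈ leafTypes c d T, NodeType.Pure x) :
    ∀ x ∈ leafTypes c d (topDownStep order (uniformDist f) T), NodeType.Pure x := by
  rcases topDownStep_cases horder (uniformDist f) T with ⟨h1, -⟩ | ⟨l, hl, i, hi, hs, -⟩
  · rwa [h1]
  · obtain ⟨X, Y, rest, hsp, h1, h2, -⟩ := h.leafTypes_split hT hl hi
    have hl' := (hp _ (List.mem_map_of_mem hl)).splits hsp
    intro x hx
    rw [hs, h2.mem_iff, List.mem_cons, List.mem_cons] at hx
    rcases hx with rfl | rfl | hx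
    · exact hl'.1
    · exact hl'.2
    · exact hp x (h1.mem_iff.2 (List.mem_cons_of_mem _ hx))

theorem TwoTerm.stage_succ (h : TwoTerm f c d) (horder : IsLoopOrder order) {T : DTree n}
    (hT : T.ReadsOnce) {a b t : ℕ} (hab : a ≤ b) (ht : 1 ≤ t) (hs : Stage c d a b t T) :
    Stage c d a b (t + 1) (topDownStep order (uniformDist f) T) := by
  rcases hs with ⟨hta, hp⟩ | ⟨m, r, rfl, hm, hr, done, hdone, hp⟩ | ⟨hta, hp⟩
  · rcases h.step_spine horder hT hab hta hp with h1 | ⟨rfl, -⟩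
    · exact h1
    · omega
  · exact stage_succ_of_unfinished hm hr hdone (h.step_unfinished horder hT hr hdone hp)
  · exact Or.inr (Or.inr ⟨by omega, h.step_pure horder hT hp⟩)

theorem leafTypes_swap (T : DTree n) :
    leafTypes d c T = (leafTypes c d T).map fun x => (x.1, x.2.2, x.2.1) := by
  simp [leafTypes, nodeType, Function.comp_def]

/-- The first split settles which term forms the spine. If it took `d`, the lengths agree and the
roles are exchanged for good. -/
theorem TwoTerm.stage_one (h : TwoTerm f c d) (horder : IsLoopOrder order) (hc : c ≠ [])
    (hcd : c.length ≤ d.length) :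
    Stage c d c.length d.length 1 (topDown order (uniformDist f) 1) ∨
    c.length = d.length ∧ Stage d c c.length d.length 1 (topDown order (uniformDist f) 1) := by
  have hpos := List.length_pos_iff.2 hc
  have h0 : (leafTypes c d (topDown order (uniformDist f) 0)).Perm
      (spine c.length d.length 0) := by
    simp [topDown, leafTypes, DTree.leaves, nodeType, rem_nil, spine]
  rcases h.step_spine horder (topDown_readsOnce_labelledBy horder _ 0).1 hcd hpos h0 with
    h1 | ⟨-, h1, h2⟩
  · exact Or.inl h1
  · right
    refine ⟨h1, stage_succ_of_spine (by omega) hpos ?_⟩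
    have h3 := h2.map fun x : NodeType => (x.1, x.2.2, x.2.1)
    rw [← leafTypes_swap] at h3
    simpa [h1, topDown] using h3

end

end TopDownMIC

namespace TopDownMIC

/-! ### The error of TopDown -/

theorem err_le_left (k : ℕ) (r s : Option ℕ) :
    NodeType.err (k, r, s) ≤ (1 / 2) ^ k * orProb (val r) (val s) :=
  mul_le_mul_of_nonneg_left (min_le_left _ _) (by positivity)

theorem err_le_right (k : ℕ) (r s : Option ℕ) :
    NodeType.err (k, r, s) ≤ (1 / 2) ^ k * (1 - orProb (val r) (val s)) :=
  mul_le_mul_of_nonneg_left (min_le_right _ _) (by positivity)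

theorem sum_err_branch_le (b i N : ℕ) :
    (((List.range N).map fun j => branch b (i + 1 + j)).map NodeType.err).sum ≤
      (1 / 2) ^ b * ((1 / 2) ^ i - (1 / 2) ^ (i + N)) := by
  induction N with
  | zero => simp
  | succ N ih =>
    have := err_le_left (i + 1 + N) none (some b)
    simp only [val, orProb] at this
    rw [List.range_succ, List.map_append, List.map_append, List.sum_append]
    simp only [List.map_cons, List.map_nil, List.sum_cons, List.sum_nil, branch] at *
    have e : (1 / 2 : ℝ) ^ (i + 1 + N) = (1 / 2) ^ (i + N) / 2 := by ring
    have e' : (1 / 2 : ℝ) ^ (i + (N + 1)) = (1 / 2) ^ (i + N) / 2 := by ring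
    rw [e] at this
    rw [e']
    linarith

theorem sum_err_pure {L : List NodeType} (hL : ∀ x ∈ L, NodeType.Pure x) :
    (L.map NodeType.err).sum = 0 := by
  refine List.sum_eq_zero fun y hy => ?_
  obtain ⟨x, hx, rfl⟩ := List.mem_map.1 hy
  exact (hL x hx).err_eq_zero

/-- The untouched branches contribute a geometric sum; the spine leaf or the current branch is added
to it, and pure leaves contribute nothing. -/
theorem Stage.sum_err_le {n : ℕ} {c d : Term n} {a b t : ℕ} (ha : 1 ≤ a) (hab : a ≤ b)
    {T : DTree n} (h : Stage c d a b t T) :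
    ((leafTypes c d T).map NodeType.err).sum ≤ (1 / 2) ^ (a + b) * leastErrors a b t := by
  have h1 : (1 / 2 : ℝ) ^ a * 2 ^ a = 1 := by rw [← mul_pow]; norm_num
  have h2 : (1 / 2 : ℝ) ^ b * 2 ^ b = 1 := by rw [← mul_pow]; norm_num
  rcases h with ⟨hta, hp⟩ | ⟨m, r, rfl, hm, hr, done, hdone, hp⟩ | ⟨hta, hp⟩
  · rw [(hp.map _).sum_eq, spine, List.map_cons, List.sum_cons]
    have h3 := sum_err_branch_le b 0 t
    simp only [zero_add, add_comm 1, pow_zero] at h3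
    refine (add_le_add_right h3 _).trans ?_
    rw [pow_add]
    have h4 : (1 / 2 : ℝ) ^ t * (1 / 2) ^ (a - t) = (1 / 2) ^ a := by
      rw [← pow_add]; congr 1; omega
    by_cases h : t + 1 < a
    · rw [leastErrors, if_pos h]
      refine (add_le_add_left (err_le_left _ _ _) _).trans (le_of_eq ?_)
      simp only [val, orProb]
      linear_combination (1 - (1 / 2 : ℝ) ^ b) * h4 - (1 / 2 : ℝ) ^ b * h1 - (1 / 2 : ℝ) ^ a * h2
    -- With one literal of the spine left, `q ≥ 1 / 2`, so the smaller error is that of label `1`.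
    · obtain rfl : a = t + 1 := by omega
      rw [leastErrors, if_neg h, if_pos rfl]
      refine (add_le_add_left (err_le_right _ _ _) _).trans (le_of_eq ?_)
      rw [show t + 1 - t = 1 by omega] at *
      simp only [val, orProb]
      rw [pow_succ, pow_succ] at h1
      rw [pow_succ, pow_succ]
      linear_combination -(1 / 2 : ℝ) ^ b * h1 - (1 / 2 : ℝ) ^ t * (1 / 2) * h2
  · rw [(hp.map _).sum_eq, List.map_append, List.sum_append, sum_err_pure hdone, add_zero,
      unfinished, List.map_cons, List.sum_cons]
    have h3 := sum_err_branch_le b (m + 1) (a - 1 - m)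
    rw [show m + 1 + (a - 1 - m) = a by omega] at h3
    refine (add_le_add (err_le_left _ _ _) h3).trans (le_of_eq ?_)
    have e : (a + b * m + r - a) / b = m := by
      rw [show a + b * m + r - a = r + b * m by omega, Nat.add_mul_div_left _ _ (by omega),
        Nat.div_eq_of_lt hr, zero_add]
    rw [leastErrors, if_neg (by omega), if_neg (by omega), e]
    have h4 : (1 / 2 : ℝ) ^ (m + 1 + r) * (1 / 2) ^ (b - r) = (1 / 2) ^ (m + 1) * (1 / 2) ^ b := by
      rw [← pow_add, ← pow_add]; congr 1; omega
    have h5 : (1 / 2 : ℝ) ^ a * 2 ^ (a - m) = (1 / 2) ^ m := by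
      rw [show (1 / 2 : ℝ) ^ a = (1 / 2) ^ m * (1 / 2) ^ (a - m) by
        rw [← pow_add]; congr 1; omega, mul_assoc, ← mul_pow]
      norm_num
    simp only [val, orProb]
    rw [pow_add _ a]
    rw [pow_succ] at *
    linear_combination h4 - (1 / 2 : ℝ) ^ b * h5
  · rw [sum_err_pure hp]
    exact mul_nonneg (by positivity) (leastErrors_nonneg a b t hab)

section

variable {n : ℕ} {f : (Fin n → Bool) → Bool} {c d : Term n}
  {order : DTree n → List (Path n × Fin n)}

theorem TwoTerm.stage_topDown (h : TwoTerm f c d) (horder : IsLoopOrder order) {a b t : ℕ}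
    (hab : a ≤ b) (ht : 1 ≤ t) (h1 : Stage c d a b 1 (topDown order (uniformDist f) 1)) :
    Stage c d a b t (topDown order (uniformDist f) t) := by
  induction t, ht using Nat.le_induction with
  | base => exact h1
  | succ t ht ih =>
    exact h.stage_succ horder (topDown_readsOnce_labelledBy horder _ t).1 hab ht ih

theorem TwoTerm.testError_topDown_le (h : TwoTerm f c d) (horder : IsLoopOrder order)
    (hc : c ≠ []) (hcd : c.length ≤ d.length) {t : ℕ} (ht : 1 ≤ t) :
    testError (uniformDist f) (topDown order (uniformDist f) t) ≤
      (1 / 2) ^ (c.length + d.length) * leastErrors c.length d.length t := by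
  have hT := topDown_readsOnce_labelledBy horder (uniformDist f) t
  have ha := List.length_pos_iff.2 hc
  rcases h.stage_one horder hc hcd with h1 | ⟨-, h1⟩
  · exact (h.testError_le hT.1 hT.2).trans ((h.stage_topDown horder hcd ht h1).sum_err_le ha hcd)
  · exact (h.symm.testError_le hT.1 hT.2).trans
      ((h.symm.stage_topDown horder hcd ht h1).sum_err_le ha hcd)

theorem TwoTerm.le_testError (h : TwoTerm f c d) (hcd : c.length ≤ d.length) (T : DTree n) :
    (1 / 2) ^ (c.length + d.length) * leastErrors c.length d.length T.size ≤
      testError (uniformDist f) T := by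
  have := errorBound_le_errAt h T [] (by simp)
  rw [testError_uniformDist]
  simpa [rem_nil, errorBound, hcd] using this

/-- An optimal tree may have fewer than `t` nodes; as `leastErrors` is antitone, its error is still
at least the bound at `t`, which TopDown does not exceed. -/
theorem TwoTerm.micConst_topDown (h : TwoTerm f c d) (horder : IsLoopOrder order) (hc : c ≠ [])
    (hcd : c.length ≤ d.length) {t : ℕ} (ht : 1 ≤ t) :
    micConst (topDown order) (uniformDist f) t = 0 := by
  have hle := isLeast_opt (uniformDist f) t
  have h1 := hle.2 ⟨_, size_topDown_le order (uniformDist f) t, rfl⟩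
  obtain ⟨T, hT, hT'⟩ := hle.1
  have h2 := h.le_testError hcd T
  have h3 := h.testError_topDown_le horder hc hcd ht
  have h4 : (1 / 2) ^ (c.length + d.length) * leastErrors c.length d.length t ≤
      (1 / 2) ^ (c.length + d.length) * leastErrors c.length d.length T.size :=
    mul_le_mul_of_nonneg_left (leastErrors_antitone hcd hT) (by positivity)
  unfold micConst
  linarith

theorem twoTerm_eval (hro : DNF.ReadOnce [c, d]) : TwoTerm (DNF.eval [c, d]) c d where
  eval x := by simp [DNF.eval]
  nodup := by simpa [DNF.ReadOnce] using hro

end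

end TopDownMIC

theorem mainTheorem3 {n : ℕ} (φ : TopDownMIC.DNF n) (htwo : φ.length = 2)
    (hne : ∀ c ∈ φ, c ≠ []) (hro : TopDownMIC.DNF.ReadOnce φ)
    (order : TopDownMIC.DTree n → List (TopDownMIC.Path n × Fin n))
    (horder : TopDownMIC.IsLoopOrder order)
    (tStar : ℕ) (ht : 0 < tStar) :
    TopDownMIC.mic (TopDownMIC.topDown order)
      (TopDownMIC.uniformDist (TopDownMIC.DNF.eval φ)) tStar = 0 := by
  obtain ⟨c, d, rfl⟩ := List.length_eq_two.1 htwo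
  have h := TopDownMIC.twoTerm_eval hro
  unfold TopDownMIC.mic
  rw [Finset.sum_eq_zero, mul_zero]
  intro t hmem
  have ht1 := (Finset.mem_Icc.1 hmem).1
  rcases le_total c.length d.length with hcd | hcd
  · exact h.micConst_topDown horder (hne c (by simp)) hcd ht1
  · exact h.symm.micConst_topDown horder (hne d (by simp)) hcd ht1
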